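/- Let $A\in\mathbb{C}^{n\times n}$, $B\in\mathbb{C}^{n\times m}$, $C\in\mathbb{C}^{l\times n}$, let $R\in\mathbb{C}^{m\times m}$ be Hermitian positive definite, put $G=BR^{-1}B^H$, $H=C^HC$, and let $r>1$ be an integer. Write $\ge$ for the Loewner order, $\mathbb{N}_n$ for the set of Hermitian positive semidefinite $n\times n$ matrices, $\|\cdot\|$ for the spectral norm, $\sigma$ and $\rho$ for spectrum and spectral radius, $\mu(M)=\min\{|\lambda|:\lambda\in\sigma(M)\}$, and $\rho_{\mathbb{D}}(M)=\max\{|\lambda|:\lambda\in\sigma(M),\ |\lambda|<1\}$ (with value $0$ if there is no such $\lambda$). DARE: $X=\mathcal{R}(X):=A^HX(I+GX)^{-1}A+H$, where $\mathrm{dom}(\mathcal{R})=\{X=X^H:\det(R+B^HXB)\ne0\}$; let $\mathcal{R}_=$ be the set of its solutions and $\mathcal{R}_\ge=\{X\in\mathrm{dom}(\mathcal{R}):X\ge\mathcal{R}(X)\}$. Put $F_X=(R+B^HXB)^{-1}B^HXA$ and $T_X=A-BF_X$. A solution $X$ is almost antistabilizing if $\mu(T_X)\ge1$. Second dual DARE: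 $Y=\mathcal{D}_2(Y):=AY(I+HY)^{-1}A^H+G$, where $\mathrm{dom}(\mathcal{D}_2)=\{Y=Y^H:\det(I+HY)\neq0\}$; put $\mathcal{D}^{(2)}_\ge=\{Y\in\mathrm{dom}(\mathcal{D}_2):Y\ge\mathcal{D}_2(Y)\}$ and $W_Y=(I+HY)^{-1}A^H$. A solution $Y$ is almost stabilizing if $\rho(W_Y)\le1$. Let $Z_0=G$, $Z_{k+1}=\mathcal{D}_2(Z_k)$. AFPI($r$): start with $(\mathbf{A}_0,\mathbf{G}_0,\mathbf{H}_0)=(A,G,H)$. Given $(\mathbf{A}_k,\mathbf{G}_k,\mathbf{H}_k)$, put $(A_k^{(1)},G_k^{(1)},H_k^{(1)})=(\mathbf{A}_k,\mathbf{G}_k,\mathbf{H}_k)$, and with $\Delta=(I+\mathbf{G}_kH_k^{(j)})^{-1}$ $$A_k^{(j+1)}=A_k^{(j)}\Delta\mathbf{A}_k,\quad G_k^{(j+1)}=G_k^{(j)}+A_k^{(j)}\Delta\mathbf{G}_k(A_k^{(j)})^H,\quad H_k^{(j+1)}=\mathbf{H}_k+\mathbf{A}_k^HH_k^{(j)}\Delta\mathbf{A}_k\qquad(1\le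 j\le r-1),$$ and $(\mathbf{A}_{k+1},\mathbf{G}_{k+1},\mathbf{H}_{k+1})=(A_k^{(r)},G_k^{(r)},H_k^{(r)})$. For an initial matrix $\widehat X_0=\widehat X_0^H$ put $\widehat X_k=\mathbf{A}_k^H\widehat X_0(I+\mathbf{G}_k\widehat X_0)^{-1}\mathbf{A}_k+\mathbf{H}_k$ for $k\ge1$. A sequence $X_k$ converges at least R-superlinearly to $X_*$ with order $r$ if $\limsup_k\|X_k-X_*\|^{1/r^k}\le s$ for some $s\in(0,1)$. Assume that $(A,B)$ is controllable (i.e. $[B,AB,\dots,A^{n-1}B]$ has rank $n$) and that $\mathcal{D}^{(2)}_\ge\cap\mathbb{N}_n\ne\emptyset$. Then all matrices $I+HZ_k$ and $I+\mathbf{G}_kH_k^{(j)}$ are nonsingular, and the following hold. (i) $\mathbf{G}_k=Z_{r^k-1}$ for all $k\ge0$. The second dual DARE has exactly one almost stabilizing solution $G_\infty$; $G_\infty>0$; and $\mathbf{G}_k$ converges at least R-superlinearly with order $r$ to $G_\infty$, with $$\limsup_{k\to\infty}\|\mathbf{G}_k-G_\infty\|^{1/r^k}\le\rho_{\mathbb{D}}(W_{G_\infty})^2<1.$$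 If $A$ is nonsingular, then $X_{-,m}:=-G_\infty^{-1}$ is the minimal negative semidefinite solution of the DARE (the least element of $\mathcal{R}_=\cap(-\mathbb{N}_n)$), it is the unique almost antistabilizing solution of the DARE, $T_{X_{-,m}}$ is nonsingular, and $\rho_{\mathbb{D}}(W_{G_\infty})=\rho_{\mathbb{D}}(T_{X_{-,m}}^{-1})$. (ii) The DARE has a minimal positive semidefinite solution $X_{+,m}$; it is also the least element of $\mathcal{R}_\ge\cap\mathbb{N}_n$; and $\mathbf{H}_k$ converges at least R-superlinearly with order $r$ to $X_{+,m}$, with $$\limsup_{k\to\infty}\|\mathbf{H}_k-X_{+,m}\|^{1/r^k}\le\rho_{\mathbb{D}}(T_{X_{+,m}})^2<1.$$ There is $X_\star\in\mathrm{dom}(\mathcal{R})$ with $\rho(T_{X_\star})<1$, and the DARE has a maximal positive semidefinite solution $X_{+,M}$. For every $X_\star\in\mathrm{dom}(\mathcal{R})$ with $\rho(T_{X_\star})<1$, the equation $X-T_{X_\star}^HXT_{X_\star}=H+F_{X_\star}^HRF_{X_\star}$ has exactly one Hermitian solution; with it as $\widehat X_0$, all $I+\mathbf{G}_k\widehat X_0$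 are nonsingular and, provided that $\rho(T_{X_{+,M}})<1$, $\widehat X_k$ converges at least R-superlinearly with order $r$ to $X_{+,M}$, with $$\limsup_{k\to\infty}\|\widehat X_k-X_{+,M}\|^{1/r^k}\le\rho(T_{X_{+,M}})^2.$$ -/

import Mathlib

open scoped Matrix ComplexOrder MatrixOrder ENNReal

noncomputable section

namespace DARE

variable {n m l : ℕ}

/-- `ρ_𝔻(M) = max {|z| : z ∈ σ(M), |z| < 1}` (with value `0` if `M` has no eigenvalue in the open
unit disk). The spectral radius `ρ(M)` is Mathlib's `spectralRadius ℂ M`. -/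
def rhoD (M : Matrix (Fin n) (Fin n) ℂ) : ℝ≥0∞ :=
  ⨆ z ∈ spectrum ℂ M ∩ Metric.ball (0 : ℂ) 1, (‖z‖₊ : ℝ≥0∞)

/-- `μ(M) = min {|z| : z ∈ σ(M)}`. -/
def mu (M : Matrix (Fin n) (Fin n) ℂ) : ℝ≥0∞ :=
  ⨅ z ∈ spectrum ℂ M, (‖z‖₊ : ℝ≥0∞)

/-- The spectral norm, i.e. the operator norm on Euclidean `ℂⁿ`. -/
def specNorm (M : Matrix (Fin n) (Fin n) ℂ) : ℝ :=
  ‖Matrix.toEuclideanCLM (n := Fin n) (𝕜 := ℂ) M‖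

/-- `limsup_k ‖X k - L‖ ^ (1 / r ^ k)`, computed in `[0, ∞]`. -/
def rootLimsup (r : ℕ) (X : ℕ → Matrix (Fin n) (Fin n) ℂ) (L : Matrix (Fin n) (Fin n) ℂ) : ℝ≥0∞ :=
  Filter.limsup (fun k : ℕ => ENNReal.ofReal (specNorm (X k - L) ^ (1 / (r : ℝ) ^ k))) Filter.atTop

/-- `X` converges at least R-superlinearly to `L` with order `r`. -/
def RSuperlinear (r : ℕ) (X : ℕ → Matrix (Fin n) (Fin n) ℂ) (L : Matrix (Fin n) (Fin n) ℂ) : Prop :=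
  ∃ s : ℝ, 0 < s ∧ s < 1 ∧ rootLimsup r X L ≤ ENNReal.ofReal s

/-- `(A, B)` is controllable: `[B, AB, …, A^(n-1) B]` has rank `n`. -/
def Controllable (A : Matrix (Fin n) (Fin n) ℂ) (B : Matrix (Fin n) (Fin m) ℂ) : Prop :=
  (Matrix.of fun (i : Fin n) (p : Fin n × Fin m) => (A ^ (p.1 : ℕ) * B) i p.2).rank = n

/-- The set `ℕ_n` of Hermitian positive semidefinite matrices. -/
def psd (n : ℕ) : Set (Matrix (Fin n) (Fin n) ℂ) := {X | X.PosSemidef}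

/-- The set of Hermitian negative semidefinite matrices. -/
def nsd (n : ℕ) : Set (Matrix (Fin n) (Fin n) ℂ) := {X | (-X).PosSemidef}

/-- `G = B R⁻¹ Bᴴ`. -/
def gMat (B : Matrix (Fin n) (Fin m) ℂ) (R : Matrix (Fin m) (Fin m) ℂ) :
    Matrix (Fin n) (Fin n) ℂ := B * R⁻¹ * Bᴴ

/-- `H = Cᴴ C`. -/
def hMat (C : Matrix (Fin l) (Fin n) ℂ) : Matrix (Fin n) (Fin n) ℂ := Cᴴ * C

/-! ### The DARE `X = 𝓡(X)` -/

/-- `dom(𝓡)`: the Hermitian `X` with `det (R + Bᴴ X B) ≠ 0`. -/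
def domR (B : Matrix (Fin n) (Fin m) ℂ) (R : Matrix (Fin m) (Fin m) ℂ) :
    Set (Matrix (Fin n) (Fin n) ℂ) :=
  {X | X.IsHermitian ∧ (R + Bᴴ * X * B).det ≠ 0}

/-- `𝓡(X) = Aᴴ X (I + G X)⁻¹ A + H`. -/
def opR (A : Matrix (Fin n) (Fin n) ℂ) (B : Matrix (Fin n) (Fin m) ℂ)
    (R : Matrix (Fin m) (Fin m) ℂ) (C : Matrix (Fin l) (Fin n) ℂ)
    (X : Matrix (Fin n) (Fin n) ℂ) : Matrix (Fin n) (Fin n) ℂ :=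
  Aᴴ * X * (1 + gMat B R * X)⁻¹ * A + hMat C

/-- `𝓡_=`: the solutions of the DARE. -/
def solR (A : Matrix (Fin n) (Fin n) ℂ) (B : Matrix (Fin n) (Fin m) ℂ)
    (R : Matrix (Fin m) (Fin m) ℂ) (C : Matrix (Fin l) (Fin n) ℂ) :
    Set (Matrix (Fin n) (Fin n) ℂ) :=
  {X | X ∈ domR B R ∧ X = opR A B R C X}

/-- `𝓡_≥`. -/
def geR (A : Matrix (Fin n) (Fin n) ℂ) (B : Matrix (Fin n) (Fin m) ℂ)
    (R : Matrix (Fin m) (Fin m) ℂ) (C : Matrix (Fin l) (Fin n) ℂ) :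
    Set (Matrix (Fin n) (Fin n) ℂ) :=
  {X | X ∈ domR B R ∧ opR A B R C X ≤ X}

/-- `F_X = (R + Bᴴ X B)⁻¹ Bᴴ X A`. -/
def fbR (A : Matrix (Fin n) (Fin n) ℂ) (B : Matrix (Fin n) (Fin m) ℂ)
    (R : Matrix (Fin m) (Fin m) ℂ) (X : Matrix (Fin n) (Fin n) ℂ) : Matrix (Fin m) (Fin n) ℂ :=
  (R + Bᴴ * X * B)⁻¹ * Bᴴ * X * A

/-- The closed-loop matrix `T_X = A - B F_X`. -/
def clR (A : Matrix (Fin n) (Fin n) ℂ) (B : Matrix (Fin n) (Fin m) ℂ)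
    (R : Matrix (Fin m) (Fin m) ℂ) (X : Matrix (Fin n) (Fin n) ℂ) : Matrix (Fin n) (Fin n) ℂ :=
  A - B * fbR A B R X

/-- `X` is an almost antistabilizing solution of the DARE. -/
def AlmostAntistabR (A : Matrix (Fin n) (Fin n) ℂ) (B : Matrix (Fin n) (Fin m) ℂ)
    (R : Matrix (Fin m) (Fin m) ℂ) (C : Matrix (Fin l) (Fin n) ℂ)
    (X : Matrix (Fin n) (Fin n) ℂ) : Prop :=
  X ∈ solR A B R C ∧ 1 ≤ mu (clR A B R X)

/-- `X₀` is a Hermitian solution of the Stein equation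
`X₀ - Tᴴ X₀ T = H + F_Sᴴ R F_S` with `T = T_S`, i.e. `X₀ = 𝓢_{T_S}⁻¹ (H_S)` if `ρ(T_S) < 1`. -/
def SteinStart (A : Matrix (Fin n) (Fin n) ℂ) (B : Matrix (Fin n) (Fin m) ℂ)
    (R : Matrix (Fin m) (Fin m) ℂ) (C : Matrix (Fin l) (Fin n) ℂ)
    (S X₀ : Matrix (Fin n) (Fin n) ℂ) : Prop :=
  X₀.IsHermitian ∧
    X₀ - (clR A B R S)ᴴ * X₀ * clR A B R S = hMat C + (fbR A B R S)ᴴ * R * fbR A B R S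

/-! ### The second dual DARE `Y = 𝓓₂(Y)` -/

/-- `dom(𝓓₂)`: the Hermitian `Y` with `det (I + H Y) ≠ 0`. -/
def domD (C : Matrix (Fin l) (Fin n) ℂ) : Set (Matrix (Fin n) (Fin n) ℂ) :=
  {Y | Y.IsHermitian ∧ (1 + hMat C * Y).det ≠ 0}

/-- `𝓓₂(Y) = A Y (I + H Y)⁻¹ Aᴴ + G`. -/
def opD (A : Matrix (Fin n) (Fin n) ℂ) (B : Matrix (Fin n) (Fin m) ℂ)
    (R : Matrix (Fin m) (Fin m) ℂ) (C : Matrix (Fin l) (Fin n) ℂ)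
    (Y : Matrix (Fin n) (Fin n) ℂ) : Matrix (Fin n) (Fin n) ℂ :=
  A * Y * (1 + hMat C * Y)⁻¹ * Aᴴ + gMat B R

/-- `𝓓_≥^{(2)}`. -/
def geD (A : Matrix (Fin n) (Fin n) ℂ) (B : Matrix (Fin n) (Fin m) ℂ)
    (R : Matrix (Fin m) (Fin m) ℂ) (C : Matrix (Fin l) (Fin n) ℂ) :
    Set (Matrix (Fin n) (Fin n) ℂ) :=
  {Y | Y ∈ domD C ∧ opD A B R C Y ≤ Y}

/-- The closed-loop matrix `W_Y = (I + H Y)⁻¹ Aᴴ` of the second dual DARE. -/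
def clD (A : Matrix (Fin n) (Fin n) ℂ) (C : Matrix (Fin l) (Fin n) ℂ)
    (Y : Matrix (Fin n) (Fin n) ℂ) : Matrix (Fin n) (Fin n) ℂ :=
  (1 + hMat C * Y)⁻¹ * Aᴴ

/-- `Y` is an almost stabilizing solution of the second dual DARE. -/
def AlmostStabD (A : Matrix (Fin n) (Fin n) ℂ) (B : Matrix (Fin n) (Fin m) ℂ)
    (R : Matrix (Fin m) (Fin m) ℂ) (C : Matrix (Fin l) (Fin n) ℂ)
    (Y : Matrix (Fin n) (Fin n) ℂ) : Prop :=
  Y ∈ domD C ∧ Y = opD A B R C Y ∧ spectralRadius ℂ (clD A C Y) ≤ 1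

/-- The fixed-point iteration `Z_{k+1} = 𝓓₂(Z_k)`, `Z_0 = G`. -/
def seqZ (A : Matrix (Fin n) (Fin n) ℂ) (B : Matrix (Fin n) (Fin m) ℂ)
    (R : Matrix (Fin m) (Fin m) ℂ) (C : Matrix (Fin l) (Fin n) ℂ) :
    ℕ → Matrix (Fin n) (Fin n) ℂ
  | 0 => gMat B R
  | k + 1 => opD A B R C (seqZ A B R C k)

/-! ### The accelerated fixed-point iteration AFPI(r) -/

/-- A triple `(A, G, H)` of `n × n` matrices. -/
structure Triple (n : ℕ) where
  /-- the `A` component -/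
  A : Matrix (Fin n) (Fin n) ℂ
  /-- the `G` component -/
  G : Matrix (Fin n) (Fin n) ℂ
  /-- the `H` component -/
  H : Matrix (Fin n) (Fin n) ℂ

/-- One pass of the inner loop: from the outer triple `P = (𝐀_k, 𝐆_k, 𝐇_k)` and the inner triple
`Q = (A_k^{(l)}, G_k^{(l)}, H_k^{(l)})` to `(A_k^{(l+1)}, G_k^{(l+1)}, H_k^{(l+1)})`. -/
def innerStep (P Q : Triple n) : Triple n where
  A := Q.A * (1 + P.G * Q.H)⁻¹ * P.A
  G := Q.G + Q.A * (1 + P.G * Q.H)⁻¹ * P.G * Q.Aᴴ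
  H := P.H + P.Aᴴ * Q.H * (1 + P.G * Q.H)⁻¹ * P.A

/-- The inner triple after `j` passes, i.e. `(A_k^{(j+1)}, G_k^{(j+1)}, H_k^{(j+1)})`, when the
outer triple is `P`. -/
def inner (P : Triple n) : ℕ → Triple n
  | 0 => P
  | j + 1 => innerStep P (inner P j)

/-- The outer triples `(𝐀_k, 𝐆_k, 𝐇_k)` of AFPI(r): each outer step makes `r - 1` passes. -/
def afpi (r : ℕ) (P₀ : Triple n) : ℕ → Triple n
  | 0 => P₀
  | k + 1 => inner (afpi r P₀ k) (r - 1)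

/-- The sequence `X̂_k` of AFPI(r) with initial matrix `X̂_0 = X₀`. -/
def afpiX (r : ℕ) (P₀ : Triple n) (X₀ : Matrix (Fin n) (Fin n) ℂ) :
    ℕ → Matrix (Fin n) (Fin n) ℂ
  | 0 => X₀
  | k + 1 =>
    (afpi r P₀ (k + 1)).Aᴴ * X₀ * (1 + (afpi r P₀ (k + 1)).G * X₀)⁻¹ * (afpi r P₀ (k + 1)).A
      + (afpi r P₀ (k + 1)).H

/-- The initial triple `(A, G, H)` of the DARE. -/
def initTriple (A : Matrix (Fin n) (Fin n) ℂ) (B : Matrix (Fin n) (Fin m) ℂ)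
    (R : Matrix (Fin m) (Fin m) ℂ) (C : Matrix (Fin l) (Fin n) ℂ) : Triple n :=
  ⟨A, gMat B R, hMat C⟩

end DARE

end

/-!
The equation and its second dual are both of the form `X = ric A G H X` with
`ric A G H X = Aᴴ X (1 + G X)⁻¹ A + H`, the dual one for the coefficients `(Aᴴ, H, G)`, so that all
facts about the Riccati operator are proved once. They rest on an exact expansion of
`X ↦ X (1 + G X)⁻¹` (`shunt_sub_shunt_quad`), which makes `ric` monotone and operator concave on
positive semidefinite matrices.

*Acceleration.* One inner pass composes Riccati operators (`ric_innerStep`), and dually in the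
reverse order. Hence the `k`-th outer triple represents the `r ^ k`-fold iterates, `𝐆_k` and `𝐇_k`
are the `r ^ k`-fold iterates of `0` under the dual and the primal operator, and `X̂_k` is the
`r ^ k`-fold iterate of `X̂_0`. Order `r` is thus linear convergence of the plain fixed-point
iteration, sampled at the times `r ^ k` (`rootLimsup_le`).

*Limits.* The iterates of `0` increase, and converge to the least solution if they are bounded. For
the dual equation the bound is the given element of `𝓓_≥`. For the primal one it comes from
controllability, which makes some dual iterate `G_N` of `0` positive definite: then
`A_Nᴴ X (1 + G_N X)⁻¹ A_N + H_N ≤ A_Nᴴ G_N⁻¹ A_N + H_N` whatever `X ≥ 0` is (`exists_iterate_le`).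
The same bound with `H` replaced by `1` gives a stabilizing feedback. The cost matrix of a stabilizing
feedback dominates every solution and is decreased by `ric` (`exists_steinStart`), so the iteration
started there decreases to the greatest solution.

*Rates.* With `Δ = X - X_j` and `T` the closed loop at the limit `X`, one step from below gives
`Δ ↦ Tᴴ (Δ + Δ N Δ) T` with `0 ≤ N ≤ G`, so that `Δ` contracts like `(T ^ j)ᴴ X T ^ j` up to factors
`(1 + ε) ^ j`. The eigenvalues of `T` outside the open unit disk do not matter: an eigenvector `x`
for such an eigenvalue satisfies `X x = 0`, for otherwise `X x` would be an uncontrollable mode; the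
same holds for generalized eigenvectors (`mulVec_eq_zero_of_pow_sub`), and then `X T ^ j` decays
like `ρ_𝔻(T) ^ j` (`exists_norm_mul_pow_le`). For the dual equation controllability excludes such
eigenvalues altogether (`spectralRadius_loop_lt_one`). From above the linearization is an upper
bound outright (`rate_of_iterate_of_le`).

*The antistabilizing solution.* For invertible `A` and a positive definite dual solution `Y`, the
matrix `-Y⁻¹` solves the equation, and its closed loop is similar to the inverse of the dual one.
Uniqueness, here and for the dual equation, follows from `X - X' = T_Xᴴ (X - X') T_X'` for any two
solutions, and minimality from the Lyapunov inequality `X + Y⁻¹ ≥ Sᴴ (X + Y⁻¹) S` with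
`S = T_{-Y⁻¹}⁻¹` stable (`neg_inv_le`).
-/

noncomputable section

namespace Riccati

open Matrix Filter Topology

/-- Complex square matrices of size `n`. -/
abbrev Mat (n : ℕ) := Matrix (Fin n) (Fin n) ℂ

variable {n m l : ℕ}

/-! ### Shunted matrices and the Riccati operator -/

/-- `X (1 + G X)⁻¹`; for positive definite `G` and `X` it is the parallel sum `(X⁻¹ + G)⁻¹`, and
it makes sense for singular `G` and `X` too. -/
def shunt (G X : Mat n) : Mat n := X * (1 + G * X)⁻¹

/-- The Riccati operator `X ↦ Aᴴ X (1 + G X)⁻¹ A + H` with coefficients `A`, `G`, `H`. Replacing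
`(A, G, H)` by `(Aᴴ, H, G)` gives the operator of the dual equation. -/
def ric (A G H X : Mat n) : Mat n := Aᴴ * shunt G X * A + H

/-- The closed-loop matrix `(1 + G X)⁻¹ A`. -/
def loop (A G X : Mat n) : Mat n := (1 + G * X)⁻¹ * A

/-- `X` is admissible for `G`: Hermitian with `1 + G X` invertible. -/
def Adm (G X : Mat n) : Prop := X.IsHermitian ∧ IsUnit (1 + G * X).det

lemma isUnit_det_comm {G X : Mat n} : IsUnit (1 + G * X).det ↔ IsUnit (1 + X * G).det := by
  rw [det_one_add_mul_comm]

lemma isUnit_det_of_posSemidef {G X : Mat n} (hG : G.PosSemidef) (hX : X.PosSemidef) :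
    IsUnit (1 + G * X).det := by
  obtain ⟨L, rfl⟩ := CStarAlgebra.nonneg_iff_eq_star_mul_self.mp hX.nonneg
  rw [star_eq_conjTranspose, ← Matrix.mul_assoc, det_one_add_mul_comm, ← Matrix.mul_assoc]
  have : (1 + L * G * Lᴴ).PosDef := PosDef.one.add_posSemidef (hG.mul_mul_conjTranspose_same L)
  exact (isUnit_iff_isUnit_det _).mp this.isUnit

lemma adm_of_posSemidef {G X : Mat n} (hG : G.PosSemidef) (hX : X.PosSemidef) : Adm G X :=
  ⟨hX.isHermitian, isUnit_det_of_posSemidef hG hX⟩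

lemma conjTranspose_inv_one_add {G X : Mat n} (hG : G.IsHermitian) (hX : X.IsHermitian) :
    ((1 + G * X)⁻¹)ᴴ = (1 + X * G)⁻¹ := by
  rw [conjTranspose_nonsing_inv, conjTranspose_add, conjTranspose_mul, hG.eq, hX.eq,
    conjTranspose_one]

lemma inv_one_add_mul {G X : Mat n} (h : IsUnit (1 + G * X).det) :
    (1 + G * X)⁻¹ * G = shunt X G := by
  have h' := isUnit_det_comm.mp h
  calc (1 + G * X)⁻¹ * G = (1 + G * X)⁻¹ * (G * (1 + X * G)) * (1 + X * G)⁻¹ := by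
        rw [Matrix.mul_assoc, Matrix.mul_assoc G, mul_nonsing_inv _ h', Matrix.mul_one]
    _ = (1 + G * X)⁻¹ * (1 + G * X) * (G * (1 + X * G)⁻¹) := by noncomm_ring
    _ = shunt X G := by rw [nonsing_inv_mul _ h, Matrix.one_mul, shunt]

lemma shunt_eq_inv_mul {G X : Mat n} (h : IsUnit (1 + G * X).det) :
    shunt G X = (1 + X * G)⁻¹ * X :=
  (inv_one_add_mul (isUnit_det_comm.mp h)).symm

lemma shunt_sub_shunt {G X Y : Mat n} (hX : IsUnit (1 + G * X).det)
    (hY : IsUnit (1 + G * Y).det) :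
    shunt G X - shunt G Y = (1 + X * G)⁻¹ * (X - Y) * (1 + G * Y)⁻¹ := by
  rw [shunt_eq_inv_mul hX, shunt]
  have h1 := nonsing_inv_mul _ (isUnit_det_comm.mp hX)
  have h2 := mul_nonsing_inv _ hY
  generalize (1 + X * G)⁻¹ = V at *
  generalize (1 + G * Y)⁻¹ = U at *
  calc V * X - Y * U = V * X * ((1 + G * Y) * U) - (V * (1 + X * G)) * Y * U := by
        rw [h1, h2]; simp
    _ = V * (X - Y) * U := by noncomm_ring

lemma inv_sub_inv {G X Y : Mat n} (hX : IsUnit (1 + G * X).det) (hY : IsUnit (1 + G * Y).det) :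
    (1 + G * Y)⁻¹ - (1 + G * X)⁻¹ = (1 + G * Y)⁻¹ * G * (X - Y) * (1 + G * X)⁻¹ := by
  have h1 := nonsing_inv_mul _ hY
  have h2 := mul_nonsing_inv _ hX
  generalize (1 + G * X)⁻¹ = V at *
  generalize (1 + G * Y)⁻¹ = U at *
  calc U - V = U * ((1 + G * X) * V) - (U * (1 + G * Y)) * V := by rw [h1, h2]; simp
    _ = _ := by noncomm_ring

/-- The second order expansion of `shunt G` at `X`, with an exact quadratic remainder. -/
lemma shunt_sub_shunt_quad {G X Y : Mat n} (hG : G.IsHermitian) (hX : Adm G X) (hY : Adm G Y) :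
    shunt G X - shunt G Y = ((1 + G * X)⁻¹)ᴴ *
      ((X - Y) + (X - Y) * shunt Y G * (X - Y)) * (1 + G * X)⁻¹ := by
  rw [shunt_sub_shunt hX.2 hY.2, conjTranspose_inv_one_add hG hX.1, ← inv_one_add_mul hY.2,
    show (1 + G * Y)⁻¹ = (1 + G * X)⁻¹ + (1 + G * Y)⁻¹ * G * (X - Y) * (1 + G * X)⁻¹ by
      rw [← inv_sub_inv hX.2 hY.2]; abel]
  rw [← inv_sub_inv hX.2 hY.2]
  have := inv_sub_inv hX.2 hY.2
  generalize (1 + G * X)⁻¹ = V at *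
  generalize (1 + G * Y)⁻¹ = U at *
  generalize (1 + X * G)⁻¹ = W at *
  calc W * (X - Y) * (V + (U - V)) = W * (X - Y) * V + W * (X - Y) * (U - V) := by noncomm_ring
    _ = W * (X - Y) * V + W * (X - Y) * (U * G * (X - Y) * V) := by rw [this]
    _ = _ := by noncomm_ring

@[simp] lemma shunt_zero_right (G : Mat n) : shunt G 0 = 0 := by simp [shunt]

@[simp] lemma shunt_zero_left (X : Mat n) : shunt 0 X = X := by simp [shunt]

lemma Adm.zero (G : Mat n) : Adm G 0 := ⟨isHermitian_zero, by simp⟩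

lemma shunt_posSemidef {G X : Mat n} (hG : G.PosSemidef) (hX : X.PosSemidef) :
    (shunt G X).PosSemidef := by
  have := shunt_sub_shunt_quad hG.1 (adm_of_posSemidef hG hX) (Adm.zero G)
  rw [shunt_zero_right, sub_zero, sub_zero, shunt_zero_left] at this
  rw [this]
  refine (hX.add ?_).conjTranspose_mul_mul_same _
  simpa only [hX.1.eq] using hG.conjTranspose_mul_mul_same X

lemma mul_mul_nonneg {N D : Mat n} (hN : N.PosSemidef) (hD : D.IsHermitian) :
    0 ≤ D * N * D := by
  have := (hN.conjTranspose_mul_mul_same D).nonneg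
  rwa [hD.eq] at this

lemma conj_mono {D E : Mat n} (h : D ≤ E) (T : Mat n) : Tᴴ * D * T ≤ Tᴴ * E * T := by
  have := (le_iff.mp h).conjTranspose_mul_mul_same T
  rw [le_iff]
  convert this using 1
  noncomm_ring

lemma shunt_mono {G X Y : Mat n} (hG : G.PosSemidef) (hX : X.PosSemidef) (h : X ≤ Y) :
    shunt G X ≤ shunt G Y := by
  have hY : Y.PosSemidef := (hX.nonneg.trans h).posSemidef
  rw [← sub_nonneg, shunt_sub_shunt_quad hG.1 (adm_of_posSemidef hG hY) (adm_of_posSemidef hG hX)]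
  have hD := (le_iff.mp h)
  have := conj_mono (add_nonneg hD.nonneg (mul_mul_nonneg (shunt_posSemidef hX hG) hD.1))
    (1 + G * Y)⁻¹
  simpa using this

/-- The first order expansion is an upper bound, as `shunt G` is operator concave. -/
lemma shunt_sub_shunt_le {G X Y : Mat n} (hG : G.PosSemidef) (hX : Adm G X)
    (hY : Y.PosSemidef) :
    shunt G Y - shunt G X ≤ ((1 + G * X)⁻¹)ᴴ * (Y - X) * (1 + G * X)⁻¹ := by
  have h := shunt_sub_shunt_quad hG.1 hX (adm_of_posSemidef hG hY)
  have hD : (X - Y).IsHermitian := hX.1.sub hY.1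
  have h0 := conj_mono (mul_mul_nonneg (shunt_posSemidef hY hG) hD) (1 + G * X)⁻¹
  rw [← neg_sub (shunt G X), h, ← sub_nonneg]
  convert h0 using 1
  · simp
  · noncomm_ring

lemma shunt_le {G X : Mat n} (hG : G.PosSemidef) (hX : X.PosSemidef) : shunt G X ≤ X := by
  simpa using shunt_sub_shunt_le hG (Adm.zero G) hX

lemma shunt_le_inv {G X : Mat n} (hG : G.PosDef) (hX : X.PosSemidef) : shunt G X ≤ G⁻¹ := by
  have hU := isUnit_det_of_posSemidef hG.posSemidef hX
  have hGd : IsUnit G.det := (isUnit_iff_isUnit_det _).mp hG.isUnit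
  have hpos : (G + G * X * G).PosDef := by
    refine hG.add_posSemidef ?_
    have := hX.conjTranspose_mul_mul_same G
    rwa [hG.1.eq] at this
  have key : G⁻¹ - shunt G X = (G + G * X * G)⁻¹ := by
    have h1 : G + G * X * G = (1 + G * X) * G := by noncomm_ring
    rw [h1, Matrix.mul_inv_rev, shunt]
    have h2 := mul_nonsing_inv _ hU
    have h3 := nonsing_inv_mul _ hGd
    generalize (1 + G * X)⁻¹ = V at *
    calc G⁻¹ - X * V = G⁻¹ * ((1 + G * X) * V) - X * V := by rw [h2, Matrix.mul_one]
      _ = G⁻¹ * V + (G⁻¹ * G) * X * V - X * V := by noncomm_ring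
      _ = G⁻¹ * V := by rw [h3]; simp
  rw [← sub_nonneg, key]
  exact hpos.inv.posSemidef.nonneg

lemma loop_conj_mul {A G X : Mat n} (D : Mat n) :
    (loop A G X)ᴴ * D * loop A G X
      = Aᴴ * (((1 + G * X)⁻¹)ᴴ * D * (1 + G * X)⁻¹) * A := by
  simp only [loop, conjTranspose_mul, Matrix.mul_assoc]

lemma ric_sub_ric_quad {A G H X Y : Mat n} (hG : G.IsHermitian) (hX : Adm G X) (hY : Adm G Y) :
    ric A G H X - ric A G H Y =
      (loop A G X)ᴴ * ((X - Y) + (X - Y) * shunt Y G * (X - Y)) * loop A G X := by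
  rw [loop_conj_mul, ← shunt_sub_shunt_quad hG hX hY, ric, ric]
  noncomm_ring

lemma ric_sub_ric {A G H X Y : Mat n} (hG : G.IsHermitian) (hX : Adm G X) (hY : Adm G Y) :
    ric A G H X - ric A G H Y = (loop A G X)ᴴ * (X - Y) * loop A G Y := by
  have h : (loop A G X)ᴴ * (X - Y) * loop A G Y
      = Aᴴ * (((1 + G * X)⁻¹)ᴴ * (X - Y) * (1 + G * Y)⁻¹) * A := by
    simp only [loop, conjTranspose_mul, Matrix.mul_assoc]
  rw [h, conjTranspose_inv_one_add hG hX.1, ← shunt_sub_shunt hX.2 hY.2, ric, ric]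
  noncomm_ring

lemma ric_mono {A G H X Y : Mat n} (hG : G.PosSemidef) (hX : X.PosSemidef) (h : X ≤ Y) :
    ric A G H X ≤ ric A G H Y :=
  add_le_add_left (conj_mono (shunt_mono hG hX h) A) H

lemma ric_sub_ric_le {A G H X Y : Mat n} (hG : G.PosSemidef) (hX : Adm G X)
    (hY : Y.PosSemidef) :
    ric A G H Y - ric A G H X ≤ (loop A G X)ᴴ * (Y - X) * loop A G X := by
  rw [loop_conj_mul]
  have := conj_mono (shunt_sub_shunt_le hG hX hY) A
  convert this using 1
  rw [ric, ric]
  noncomm_ring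

lemma ric_posSemidef {A G H X : Mat n} (hG : G.PosSemidef) (hH : H.PosSemidef)
    (hX : X.PosSemidef) : (ric A G H X).PosSemidef :=
  ((shunt_posSemidef hG hX).conjTranspose_mul_mul_same A).add hH

@[simp] lemma ric_zero (A G H : Mat n) : ric A G H 0 = H := by simp [ric]

/-- The Lyapunov form of the Riccati operator. -/
lemma ric_eq_loop {A G H X : Mat n} (hG : G.IsHermitian) (hX : Adm G X) :
    ric A G H X = (loop A G X)ᴴ * (X + X * G * X) * loop A G X + H := by
  have := ric_sub_ric_quad (A := A) (H := H) hG hX (Adm.zero G)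
  rw [ric_zero, sub_zero, shunt_zero_left] at this
  rw [← this]; abel

lemma ric_eq_mul_loop {A G H X : Mat n} : ric A G H X = Aᴴ * X * loop A G X + H := by
  rw [ric, shunt, loop]; noncomm_ring

lemma iterate_ric_posSemidef {A G H X : Mat n} (hG : G.PosSemidef) (hH : H.PosSemidef)
    (hX : X.PosSemidef) (j : ℕ) : ((ric A G H)^[j] X).PosSemidef := by
  induction j with
  | zero => exact hX
  | succ j ih =>
    rw [Function.iterate_succ_apply']
    exact ric_posSemidef hG hH ih

lemma iterate_ric_mono {A G H X Y : Mat n} (hG : G.PosSemidef) (hH : H.PosSemidef)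
    (hX : X.PosSemidef) (h : X ≤ Y) (j : ℕ) : (ric A G H)^[j] X ≤ (ric A G H)^[j] Y := by
  induction j with
  | zero => exact h
  | succ j ih =>
    rw [Function.iterate_succ_apply', Function.iterate_succ_apply']
    exact ric_mono hG (iterate_ric_posSemidef hG hH hX j) ih

section Norm

open scoped Matrix.Norms.L2Operator

/-! ### Growth of matrix powers -/

/-- The vectors `x` with `‖L Tⁱ x‖ = O(qⁱ)`. -/
def geomSubmodule (L T : Mat n) (q : ℝ) : Submodule ℂ (Fin n → ℂ) where
  carrier := {x | ∃ c : ℝ, ∀ i : ℕ, ‖L *ᵥ (T ^ i *ᵥ x)‖ ≤ c * q ^ i}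
  zero_mem' := ⟨0, fun i => by simp⟩
  add_mem' := by
    rintro x y ⟨c, hc⟩ ⟨d, hd⟩
    refine ⟨c + d, fun i => ?_⟩
    rw [mulVec_add, mulVec_add, add_mul]
    exact (norm_add_le _ _).trans (add_le_add (hc i) (hd i))
  smul_mem' := by
    rintro z x ⟨c, hc⟩
    refine ⟨‖z‖ * c, fun i => ?_⟩
    rw [mulVec_smul, mulVec_smul, norm_smul, mul_assoc]
    exact mul_le_mul_of_nonneg_left (hc i) (norm_nonneg z)

/-- A solution of `u_{i+1} = z u_i + v_i` with `‖v_i‖ = O(qⁱ)` and `‖z‖ < q` is `O(qⁱ)`. -/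
lemma geom_bound_of_recurrence {E : Type*} [NormedAddCommGroup E] [NormedSpace ℂ E] {u v : ℕ → E}
    {z : ℂ} {q c : ℝ} (hz : ‖z‖ < q) (huv : ∀ i, u (i + 1) = z • u i + v i)
    (hv : ∀ i, ‖v i‖ ≤ c * q ^ i) : ∃ d : ℝ, ∀ i, ‖u i‖ ≤ d * q ^ i := by
  have hq : 0 < q := (norm_nonneg z).trans_lt hz
  refine ⟨max ‖u 0‖ (c / (q - ‖z‖)), fun i => ?_⟩
  have hc : c ≤ max ‖u 0‖ (c / (q - ‖z‖)) * (q - ‖z‖) :=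
    (div_le_iff₀ (sub_pos.mpr hz)).mp (le_max_right _ _)
  have h0 := le_max_left ‖u 0‖ (c / (q - ‖z‖))
  generalize max ‖u 0‖ (c / (q - ‖z‖)) = d at *
  induction i with
  | zero => simpa using h0
  | succ i ih =>
    have hqi : 0 ≤ q ^ i := by positivity
    rw [huv]
    calc ‖z • u i + v i‖ ≤ ‖z‖ * ‖u i‖ + ‖v i‖ := (norm_add_le _ _).trans (by rw [norm_smul])
      _ ≤ ‖z‖ * (d * q ^ i) + (d * (q - ‖z‖)) * q ^ i := by
        gcongr
        exact (hv i).trans (mul_le_mul_of_nonneg_right hc hqi)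
      _ = d * q ^ (i + 1) := by ring

lemma mem_geomSubmodule_of_pow {L T : Mat n} {q : ℝ} {z : ℂ} (hz : ‖z‖ < q) (k : ℕ) :
    ∀ x : Fin n → ℂ, (T - z • 1) ^ k *ᵥ x = 0 → x ∈ geomSubmodule L T q := by
  induction k with
  | zero =>
    intro x hx
    rw [pow_zero, one_mulVec] at hx
    rw [hx]
    exact zero_mem _
  | succ k ih =>
    intro x hx
    rw [pow_succ, ← mulVec_mulVec] at hx
    obtain ⟨c, hc⟩ := ih _ hx
    have hTx : T *ᵥ x = z • x + (T - z • 1) *ᵥ x := by simp [sub_mulVec, smul_mulVec]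
    refine geom_bound_of_recurrence hz (fun i => ?_) hc
    rw [pow_succ, ← mulVec_mulVec, hTx]
    simp only [mulVec_add, mulVec_smul]

lemma geomSubmodule_eq_top {L T : Mat n} {q : ℝ}
    (h : ∀ z ∈ spectrum ℂ T, ‖z‖ < q ∨
      ∀ (k : ℕ) (x : Fin n → ℂ), (T - z • 1) ^ k *ᵥ x = 0 → L *ᵥ x = 0) :
    geomSubmodule L T q = ⊤ := by
  rw [eq_top_iff, ← Module.End.iSup_maxGenEigenspace_eq_top (toLin' T)]
  refine iSup_le fun z x hx => ?_
  obtain ⟨k, hk⟩ := (Module.End.mem_maxGenEigenspace _ _ _).mp hx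
  replace hk : (T - z • 1) ^ k *ᵥ x = 0 := by
    have h1 : toLin' T - z • 1 = toLin' (T - z • 1) := by
      rw [map_sub, map_smul, toLin'_one, Module.End.one_eq_id]
    rwa [h1, ← toLin'_pow, toLin'_apply] at hk
  clear hx
  by_cases hz : z ∈ spectrum ℂ T
  · rcases h z hz with hzq | hL
    · exact mem_geomSubmodule_of_pow hzq k x hk
    · refine ⟨0, fun i => ?_⟩
      have hcomm : Commute ((T - z • 1) ^ k) (T ^ i) :=
        (((Commute.refl T).sub_left ((Commute.one_left T).smul_left z)).pow_pow k i)
      rw [hL k (T ^ i *ᵥ x) (by rw [mulVec_mulVec, hcomm.eq, ← mulVec_mulVec, hk, mulVec_zero])]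
      simp
  · -- off the spectrum `T - z` is invertible, so the generalized eigenspace is trivial
    have hu : IsUnit (T - z • 1) := by
      rw [spectrum.notMem_iff, Algebra.algebraMap_eq_smul_one] at hz
      rw [← neg_sub]
      exact hz.neg
    obtain ⟨V, hV⟩ := (hu.pow k).exists_left_inv
    have : x = 0 := by
      rw [← one_mulVec x, ← hV, ← mulVec_mulVec, hk, mulVec_zero]
    rw [this]
    exact zero_mem _

lemma exists_norm_le_of_entries {u : ℕ → Mat n} {q : ℝ}
    (h : ∀ a b, ∃ c : ℝ, ∀ i, ‖u i a b‖ ≤ c * q ^ i) : ∃ c : ℝ, ∀ i, ‖u i‖ ≤ c * q ^ i := by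
  choose c hc using h
  refine ⟨∑ a, ∑ b, c a b * ‖(single a b 1 : Mat n)‖, fun i => ?_⟩
  conv_lhs => rw [matrix_eq_sum_single (u i)]
  rw [Finset.sum_mul]
  refine (norm_sum_le _ _).trans (Finset.sum_le_sum fun a _ => ?_)
  rw [Finset.sum_mul]
  refine (norm_sum_le _ _).trans (Finset.sum_le_sum fun b _ => ?_)
  have : single a b (u i a b) = u i a b • (single a b 1 : Mat n) := by simp [smul_single]
  rw [this, norm_smul, mul_right_comm]
  exact mul_le_mul_of_nonneg_right (hc a b i) (norm_nonneg _)

/-- If `L` kills the generalized eigenspaces of `T` for all eigenvalues of modulus at least `q`,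
then `‖L Tⁱ‖ = O(qⁱ)`. -/
theorem exists_norm_mul_pow_le {L T : Mat n} {q : ℝ}
    (h : ∀ z ∈ spectrum ℂ T, ‖z‖ < q ∨
      ∀ (k : ℕ) (x : Fin n → ℂ), (T - z • 1) ^ k *ᵥ x = 0 → L *ᵥ x = 0) :
    ∃ c : ℝ, ∀ i, ‖L * T ^ i‖ ≤ c * q ^ i := by
  have htop := geomSubmodule_eq_top h
  refine exists_norm_le_of_entries fun a b => ?_
  obtain ⟨c, hc⟩ : Pi.single b 1 ∈ geomSubmodule L T q := htop ▸ Submodule.mem_top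
  refine ⟨c, fun i => le_trans ?_ (hc i)⟩
  refine le_trans (le_of_eq ?_) (norm_le_pi_norm _ a)
  rw [mulVec_mulVec, mulVec_single_one, col_apply]

lemma norm_lt_of_spectralRadius_lt {T : Mat n} {q : ℝ} (h : spectralRadius ℂ T < ENNReal.ofReal q)
    {z : ℂ} (hz : z ∈ spectrum ℂ T) : ‖z‖ < q := by
  have h1 : (‖z‖₊ : ℝ≥0∞) < ENNReal.ofReal q :=
    lt_of_le_of_lt (le_iSup₂ (f := fun z (_ : z ∈ spectrum ℂ T) => (‖z‖₊ : ℝ≥0∞)) z hz) h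
  rw [← enorm_eq_nnnorm, ← ofReal_norm] at h1
  exact (ENNReal.ofReal_lt_ofReal_iff_of_nonneg (norm_nonneg z)).mp h1

lemma exists_norm_pow_le {T : Mat n} {q : ℝ} (h : spectralRadius ℂ T < ENNReal.ofReal q) :
    ∃ c : ℝ, ∀ i, ‖T ^ i‖ ≤ c * q ^ i := by
  obtain ⟨c, hc⟩ := exists_norm_mul_pow_le (L := 1)
    fun z hz => Or.inl (norm_lt_of_spectralRadius_lt h hz)
  exact ⟨c, fun i => by simpa using hc i⟩

/-- `ρ(T) < 1` leaves room for `q < 1`, `p > 1` with `ρ(T) < q` and `p q < 1`. -/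
lemma exists_between_spectralRadius {T : Mat n} (h : spectralRadius ℂ T < 1) :
    ∃ q p : ℝ, 0 < q ∧ 1 < p ∧ p * q < 1 ∧ spectralRadius ℂ T < ENNReal.ofReal q := by
  obtain ⟨q, hq0, hq1, hq2⟩ := ENNReal.lt_iff_exists_real_btwn.mp h
  have hq : 0 < q := ENNReal.ofReal_pos.mp (bot_le.trans_lt hq1)
  have hq' : q < 1 := by
    rw [← ENNReal.ofReal_one] at hq2
    exact (ENNReal.ofReal_lt_ofReal_iff one_pos).mp hq2
  refine ⟨q, (1 + q⁻¹) / 2, hq, ?_, ?_, hq1⟩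
  · have := (one_lt_inv₀ hq).mpr hq'
    linarith
  · field_simp
    linarith

lemma eq_zero_of_norm_le_geom {D : Mat n} {c s : ℝ} (hs0 : 0 ≤ s) (hs : s < 1)
    (h : ∀ i : ℕ, ‖D‖ ≤ c * s ^ i) : D = 0 := by
  have ht : Tendsto (fun i : ℕ => c * s ^ i) atTop (𝓝 (c * 0)) :=
    (tendsto_pow_atTop_nhds_zero_of_lt_one hs0 hs).const_mul c
  rw [mul_zero] at ht
  have := ge_of_tendsto' ht h
  exact norm_le_zero_iff.mp this

lemma conj_iterate {U D W : Mat n} (h : D = Uᴴ * D * W) (i : ℕ) :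
    D = (U ^ i)ᴴ * D * W ^ i := by
  induction i with
  | zero => simp
  | succ i ih =>
    calc D = Uᴴ * D * W := h
      _ = Uᴴ * ((U ^ i)ᴴ * D * W ^ i) * W := by rw [← ih]
      _ = _ := by
        rw [pow_succ U, pow_succ W, conjTranspose_mul]
        noncomm_ring

/-- The Sylvester operator `D ↦ D - Uᴴ D W` is injective if `ρ(U) ≤ 1` and `ρ(W) < 1`. -/
theorem eq_zero_of_eq_conj {U D W : Mat n} (hU : spectralRadius ℂ U ≤ 1)
    (hW : spectralRadius ℂ W < 1) (h : D = Uᴴ * D * W) : D = 0 := by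
  obtain ⟨q, p, hq, hp, hpq, hWq⟩ := exists_between_spectralRadius hW
  have hUp : spectralRadius ℂ U < ENNReal.ofReal p := by
    refine hU.trans_lt ?_
    rw [← ENNReal.ofReal_one]
    exact (ENNReal.ofReal_lt_ofReal_iff (by linarith)).mpr hp
  obtain ⟨c, hc⟩ := exists_norm_pow_le hUp
  obtain ⟨d, hd⟩ := exists_norm_pow_le hWq
  refine eq_zero_of_norm_le_geom (c := c * ‖D‖ * d) (by positivity) hpq fun i => ?_
  conv_lhs => rw [conj_iterate h i]
  calc ‖(U ^ i)ᴴ * D * W ^ i‖ ≤ ‖(U ^ i)ᴴ‖ * ‖D‖ * ‖W ^ i‖ :=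
        (norm_mul_le _ _).trans (mul_le_mul_of_nonneg_right (norm_mul_le _ _) (norm_nonneg _))
    _ ≤ (c * p ^ i) * ‖D‖ * (d * q ^ i) := by
        rw [l2_opNorm_conjTranspose]
        have h1 := hc i
        have h2 := hd i
        have h3 := norm_nonneg (U ^ i)
        have h4 := norm_nonneg (W ^ i)
        have h5 := h3.trans h1
        gcongr
    _ = _ := by rw [mul_pow]; ring

lemma conj_iterate_le {T D : Mat n} (h : Tᴴ * D * T ≤ D) (i : ℕ) :
    (T ^ i)ᴴ * D * T ^ i ≤ D := by
  induction i with
  | zero => simp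
  | succ i ih =>
    refine le_trans (le_of_eq ?_) ((conj_mono ih T).trans h)
    rw [pow_succ T, conjTranspose_mul]
    noncomm_ring

lemma tendsto_pow_zero {T : Mat n} (hT : spectralRadius ℂ T < 1) :
    Tendsto (fun i : ℕ => T ^ i) atTop (𝓝 0) := by
  obtain ⟨q, p, hq, hp, hpq, hTq⟩ := exists_between_spectralRadius hT
  obtain ⟨c, hc⟩ := exists_norm_pow_le hTq
  refine squeeze_zero_norm hc ?_
  have hq1 : q < 1 := by nlinarith
  simpa using (tendsto_pow_atTop_nhds_zero_of_lt_one hq.le hq1).const_mul c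

/-- Lyapunov's theorem: `D ≥ Tᴴ D T` with `ρ(T) < 1` forces `D ≥ 0`. -/
theorem nonneg_of_conj_le {T D : Mat n} (hT : spectralRadius ℂ T < 1) (h : Tᴴ * D * T ≤ D) :
    0 ≤ D := by
  have hpow := tendsto_pow_zero hT
  have ht : Tendsto (fun i : ℕ => (T ^ i)ᴴ * D * T ^ i) atTop (𝓝 ((0 : Mat n)ᴴ * D * 0)) :=
    ((Continuous.matrix_conjTranspose continuous_id).tendsto _ |>.comp hpow |>.mul_const D).mul hpow
  rw [mul_zero] at ht
  exact le_of_tendsto' ht fun i => conj_iterate_le h i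

/-! ### Monotone limits of the Riccati iteration -/

lemma isCompact_Icc_zero (M : Mat n) : IsCompact (Set.Icc 0 M) :=
  (isCompact_closedBall (0 : Mat n) ‖M‖).of_isClosed_subset isClosed_Icc fun X hX => by
    rw [mem_closedBall_zero_iff]
    exact CStarAlgebra.norm_le_norm_of_nonneg_of_le hX.1 hX.2

lemma tendsto_of_monotone_of_mem_Icc {u : ℕ → Mat n} {M : Mat n} (hu : Monotone u)
    (hM : ∀ j, u j ∈ Set.Icc 0 M) : ∃ X, Tendsto u atTop (𝓝 X) := by
  obtain ⟨X, -, φ, hφ, hX⟩ := (isCompact_Icc_zero M).tendsto_subseq hM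
  -- a cluster point of a monotone sequence is its least upper bound
  have hlub : ∀ Y, MapClusterPt Y atTop u → ∀ Z, (∀ j, u j ≤ Z) → Y ≤ Z := fun Y hY Z hZ =>
    isClosed_Iic.mem_of_mapClusterPt hY (Eventually.of_forall hZ)
  have hub : ∀ Y, MapClusterPt Y atTop u → ∀ j, u j ≤ Y := fun Y hY j =>
    isClosed_Ici.mem_of_mapClusterPt hY (eventually_ge_atTop j |>.mono fun i hi => hu hi)
  have hXc : MapClusterPt X atTop u := hX.mapClusterPt.of_comp hφ.tendsto_atTop
  refine ⟨X, (isCompact_Icc_zero M).tendsto_nhds_of_unique_mapClusterPt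
    (Eventually.of_forall hM) fun Y _ hY => ?_⟩
  exact le_antisymm (hlub Y hY X (hub X hXc)) (hlub X hXc Y (hub Y hY))

lemma continuousAt_ric {A G H X : Mat n} (hG : G.PosSemidef) (hX : X.PosSemidef) :
    ContinuousAt (ric A G H) X := by
  have hu : IsUnit (1 + G * X) := (isUnit_iff_isUnit_det _).mpr (isUnit_det_of_posSemidef hG hX)
  obtain ⟨w, hw⟩ := hu
  have hinv : ContinuousAt (fun Y : Mat n => (1 + G * Y)⁻¹) X := by
    simp only [nonsing_inv_eq_ringInverse]
    have h1 : ContinuousAt (fun Y : Mat n => 1 + G * Y) X := by fun_prop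
    refine ContinuousAt.comp (g := Ring.inverse) ?_ h1
    rw [← hw]
    exact NormedRing.inverse_continuousAt w
  unfold ric shunt
  fun_prop

lemma ric_fixed_of_tendsto {A G H X X₀ : Mat n} (hG : G.PosSemidef) (hX : X.PosSemidef)
    (h : Tendsto (fun j => (ric A G H)^[j] X₀) atTop (𝓝 X)) : ric A G H X = X := by
  have h1 : Tendsto (fun j => (ric A G H)^[j + 1] X₀) atTop (𝓝 X) := h.comp (tendsto_add_atTop_nat 1)
  have h2 := (continuousAt_ric (A := A) (H := H) hG hX).tendsto.comp h
  simp only [Function.iterate_succ_apply'] at h1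
  exact tendsto_nhds_unique h2 h1

lemma iterate_zero_le {A G H Y : Mat n} (hG : G.PosSemidef) (hH : H.PosSemidef)
    (hY : Y.PosSemidef) (hYr : ric A G H Y ≤ Y) (j : ℕ) : (ric A G H)^[j] 0 ≤ Y := by
  induction j with
  | zero => exact hY.nonneg
  | succ j ih =>
    rw [Function.iterate_succ_apply']
    exact (ric_mono hG (iterate_ric_posSemidef hG hH PosSemidef.zero j) ih).trans hYr

/-- If the iterates of `0` are bounded, they increase to the least positive semidefinite
solution, which is also the least positive semidefinite `Y` with `ric A G H Y ≤ Y`. -/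
theorem exists_tendsto_iterate_zero {A G H : Mat n} (hG : G.PosSemidef) (hH : H.PosSemidef)
    {M : Mat n} (hM : ∀ j, (ric A G H)^[j] 0 ≤ M) :
    ∃ X : Mat n, X.PosSemidef ∧ ric A G H X = X ∧
      Tendsto (fun j => (ric A G H)^[j] 0) atTop (𝓝 X) ∧
      (∀ j, (ric A G H)^[j] 0 ≤ X) ∧ ∀ Y : Mat n, Y.PosSemidef → ric A G H Y ≤ Y → X ≤ Y := by
  have hpsd := fun j => iterate_ric_posSemidef (A := A) hG hH PosSemidef.zero j
  have hmono : Monotone fun j => (ric A G H)^[j] 0 := monotone_nat_of_le_succ fun j => by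
    rw [Function.iterate_succ_apply]
    exact iterate_ric_mono hG hH PosSemidef.zero (by simpa using hH.nonneg) j
  obtain ⟨X, hX⟩ := tendsto_of_monotone_of_mem_Icc hmono fun j => ⟨(hpsd j).nonneg, hM j⟩
  have hXp : X.PosSemidef := (ge_of_tendsto' hX fun j => (hpsd j).nonneg).posSemidef
  refine ⟨X, hXp, ric_fixed_of_tendsto hG hXp hX, hX, hmono.ge_of_tendsto hX, fun Y hY hYr => ?_⟩
  exact le_of_tendsto' hX fun j => iterate_zero_le hG hH hY hYr j

lemma le_iterate_of_fixed {A G H X X₀ : Mat n} (hG : G.PosSemidef) (hX : X.PosSemidef)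
    (hfix : ric A G H X = X) (h : X ≤ X₀) (j : ℕ) : X ≤ (ric A G H)^[j] X₀ := by
  induction j with
  | zero => exact h
  | succ j ih =>
    rw [Function.iterate_succ_apply']
    exact hfix.ge.trans (ric_mono hG hX ih)

/-- The iterates of some `X₀ ≥ ric A G H X₀` decrease to the greatest solution below `X₀`. -/
theorem exists_tendsto_iterate_of_ric_le {A G H X₀ : Mat n} (hG : G.PosSemidef)
    (hH : H.PosSemidef) (hX₀ : X₀.PosSemidef) (h : ric A G H X₀ ≤ X₀) :
    ∃ X : Mat n, X.PosSemidef ∧ ric A G H X = X ∧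
      Tendsto (fun j => (ric A G H)^[j] X₀) atTop (𝓝 X) ∧ X ≤ X₀ ∧
      ∀ Y : Mat n, Y.PosSemidef → ric A G H Y = Y → Y ≤ X₀ → Y ≤ X := by
  have hpsd := fun j => iterate_ric_posSemidef (A := A) hG hH hX₀ j
  have hanti : Antitone fun j => (ric A G H)^[j] X₀ := antitone_nat_of_succ_le fun j => by
    rw [Function.iterate_succ_apply]
    exact iterate_ric_mono hG hH (ric_posSemidef hG hH hX₀) h j
  obtain ⟨Z, hZ⟩ := tendsto_of_monotone_of_mem_Icc (u := fun j => X₀ - (ric A G H)^[j] X₀)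
    (M := X₀) (fun i j hij => sub_le_sub_left (hanti hij) _)
    fun j => ⟨sub_nonneg.mpr (hanti (Nat.zero_le j)), sub_le_self _ (hpsd j).nonneg⟩
  have hX : Tendsto (fun j => (ric A G H)^[j] X₀) atTop (𝓝 (X₀ - Z)) := by
    simpa using hZ.const_sub X₀
  have hXp : (X₀ - Z).PosSemidef := (ge_of_tendsto' hX fun j => (hpsd j).nonneg).posSemidef
  exact ⟨X₀ - Z, hXp, ric_fixed_of_tendsto hG hXp hX, hX, hanti.le_of_tendsto hX 0,
    fun Y hY hfix hYX => ge_of_tendsto' hX fun j => le_iterate_of_fixed hG hY hfix hYX j⟩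

/-! ### Spectrum of the closed loop -/

/-- `(A, G)` has no uncontrollable mode: no eigenvector of `Aᴴ` lies in the kernel of `G`. -/
def NoHiddenMode (A G : Mat n) : Prop :=
  ∀ (y : Fin n → ℂ) (z : ℂ), Aᴴ *ᵥ y = z • y → G *ᵥ y = 0 → y = 0

lemma quad_nonneg {X : Mat n} (hX : X.PosSemidef) (x : Fin n → ℂ) :
    0 ≤ star x ⬝ᵥ X *ᵥ x := hX.dotProduct_mulVec_nonneg x

lemma star_dotProduct_conj (T X : Mat n) (x : Fin n → ℂ) :
    star x ⬝ᵥ (Tᴴ * X * T) *ᵥ x = star (T *ᵥ x) ⬝ᵥ X *ᵥ (T *ᵥ x) := by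
  rw [star_mulVec, ← mulVec_mulVec, ← mulVec_mulVec, dotProduct_mulVec, ← dotProduct_mulVec]

/-- An eigenvector `x` of the closed loop modulo `ker X`, with eigenvalue outside the open unit
disk, makes all terms of the Lyapunov form of the equation vanish. -/
lemma mulVec_eq_zero_of_eigen {A G H X : Mat n} (hG : G.PosSemidef) (hH : H.PosSemidef)
    (hX : X.PosSemidef) (hfix : ric A G H X = X) {z : ℂ} (hz : 1 ≤ ‖z‖) {x : Fin n → ℂ}
    (hXT : X *ᵥ (loop A G X *ᵥ x) = z • X *ᵥ x) : G *ᵥ (X *ᵥ x) = 0 ∧ H *ᵥ x = 0 := by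
  have hlyap := ric_eq_loop (A := A) (H := H) hG.1 (adm_of_posSemidef hG hX)
  rw [hfix] at hlyap
  set T := loop A G X
  have hX1 : star (T *ᵥ x) ⬝ᵥ X *ᵥ (T *ᵥ x) = (‖z‖ ^ 2 : ℝ) * (star x ⬝ᵥ X *ᵥ x) := by
    have : star (T *ᵥ x) ⬝ᵥ X *ᵥ x = star (X *ᵥ (T *ᵥ x)) ⬝ᵥ x := by
      rw [star_mulVec X, hX.1.eq, dotProduct_mulVec]
    rw [hXT, dotProduct_smul, this, hXT, star_smul, smul_dotProduct, star_mulVec, hX.1.eq,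
      ← dotProduct_mulVec, smul_smul, smul_eq_mul, ← Complex.normSq_eq_norm_sq]
    rw [RCLike.star_def, Complex.mul_conj]
  have hX2 : star (T *ᵥ x) ⬝ᵥ (X * G * X) *ᵥ (T *ᵥ x)
      = (‖z‖ ^ 2 : ℝ) * (star (X *ᵥ x) ⬝ᵥ G *ᵥ (X *ᵥ x)) := by
    have h1 := star_dotProduct_conj X G (T *ᵥ x)
    rw [hX.1.eq] at h1
    rw [h1, hXT, mulVec_smul, dotProduct_smul, star_smul, smul_dotProduct, smul_smul,
      smul_eq_mul, ← Complex.normSq_eq_norm_sq, RCLike.star_def, Complex.mul_conj]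
  have hquad : star x ⬝ᵥ X *ᵥ x = (‖z‖ ^ 2 : ℝ) * (star x ⬝ᵥ X *ᵥ x)
      + (‖z‖ ^ 2 : ℝ) * (star (X *ᵥ x) ⬝ᵥ G *ᵥ (X *ᵥ x)) + star x ⬝ᵥ H *ᵥ x := by
    conv_lhs => rw [hlyap]
    rw [add_mulVec, dotProduct_add, star_dotProduct_conj, add_mulVec, dotProduct_add, hX1, hX2]
  have ha := quad_nonneg hX x
  have hg := quad_nonneg hG (X *ᵥ x)
  have hh := quad_nonneg hH x
  have hz2 : (1 : ℝ) ≤ ‖z‖ ^ 2 := one_le_pow₀ hz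
  have hz1 : (0 : ℂ) ≤ ((‖z‖ ^ 2 - 1 : ℝ) : ℂ) := by
    exact_mod_cast sub_nonneg.mpr hz2
  have hz0 : (0 : ℂ) ≤ ((‖z‖ ^ 2 : ℝ) : ℂ) := by
    exact_mod_cast zero_le_one.trans hz2
  have hsum : ((‖z‖ ^ 2 - 1 : ℝ) : ℂ) * (star x ⬝ᵥ X *ᵥ x)
      + (‖z‖ ^ 2 : ℝ) * (star (X *ᵥ x) ⬝ᵥ G *ᵥ (X *ᵥ x)) + star x ⬝ᵥ H *ᵥ x = 0 := by
    rw [Complex.ofReal_sub, Complex.ofReal_one]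
    linear_combination -hquad
  have h1 := mul_nonneg hz1 ha
  have h2 := mul_nonneg hz0 hg
  obtain ⟨h3, h4⟩ := (add_eq_zero_iff_of_nonneg (add_nonneg h1 h2) hh).mp hsum
  have h5 := ((add_eq_zero_iff_of_nonneg h1 h2).mp h3).2
  have hzne : z ≠ 0 := by
    rintro rfl
    norm_num at hz
  refine ⟨?_, (hH.dotProduct_mulVec_zero_iff x).mp h4⟩
  rw [← hG.dotProduct_mulVec_zero_iff]
  refine (mul_eq_zero.mp h5).resolve_left ?_
  simp [hzne]

/-- A positive semidefinite solution vanishes on the generalized eigenspaces of the closed loop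
outside the open unit disk, for otherwise some `X x` would be an uncontrollable mode. -/
theorem mulVec_eq_zero_of_pow_sub {A G H X : Mat n} (hG : G.PosSemidef) (hH : H.PosSemidef)
    (hX : X.PosSemidef) (hfix : ric A G H X = X) (hAG : NoHiddenMode A G) {z : ℂ}
    (hz : 1 ≤ ‖z‖) (k : ℕ) :
    ∀ x : Fin n → ℂ, (loop A G X - z • 1) ^ k *ᵥ x = 0 → X *ᵥ x = 0 := by
  induction k with
  | zero =>
    intro x hx
    rw [pow_zero, one_mulVec] at hx
    rw [hx, mulVec_zero]
  | succ k ih =>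
    intro x hx
    rw [pow_succ, ← mulVec_mulVec] at hx
    have hy := ih _ hx
    have hXT : X *ᵥ (loop A G X *ᵥ x) = z • X *ᵥ x := by
      rw [sub_mulVec, smul_mulVec, one_mulVec, mulVec_sub, mulVec_smul] at hy
      exact sub_eq_zero.mp hy
    obtain ⟨hGX, hHx⟩ := mulVec_eq_zero_of_eigen hG hH hX hfix hz hXT
    have hlin := ric_eq_mul_loop (A := A) (G := G) (H := H) (X := X)
    rw [hfix] at hlin
    have hzne : z ≠ 0 := by
      rintro rfl
      norm_num at hz
    refine hAG _ z⁻¹ ?_ hGX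
    have h6 : X *ᵥ x = z • Aᴴ *ᵥ (X *ᵥ x) := by
      conv_lhs => rw [hlin]
      rw [add_mulVec, hHx, add_zero, ← mulVec_mulVec, ← mulVec_mulVec, hXT, mulVec_smul]
    conv_rhs => rw [h6]
    rw [smul_smul, inv_mul_cancel₀ hzne, one_smul]

lemma biSup_lt_of_finite {s : Set ℂ} (hs : s.Finite) {c : ℝ≥0∞} (hc : 0 < c)
    (h : ∀ z ∈ s, (‖z‖₊ : ℝ≥0∞) < c) : ⨆ z ∈ s, (‖z‖₊ : ℝ≥0∞) < c := by
  have : ⨆ z ∈ s, (‖z‖₊ : ℝ≥0∞) = hs.toFinset.sup fun z => (‖z‖₊ : ℝ≥0∞) := by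
    rw [Finset.sup_eq_iSup]
    simp
  rw [this]
  exact (Finset.sup_lt_iff hc).mpr fun z hz => h z (hs.mem_toFinset.mp hz)

lemma spectralRadius_lt_one {T : Mat n} (h : ∀ z ∈ spectrum ℂ T, ‖z‖ < 1) :
    spectralRadius ℂ T < 1 :=
  biSup_lt_of_finite (Matrix.finite_spectrum T) one_pos fun z hz => by exact_mod_cast h z hz

lemma rhoD_lt_one (T : Mat n) : DARE.rhoD T < 1 :=
  biSup_lt_of_finite ((Matrix.finite_spectrum T).inter_of_left _) one_pos fun z hz => by
    exact_mod_cast mem_ball_zero_iff.mp hz.2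

lemma exists_eigenvector {T : Mat n} {z : ℂ} (hz : z ∈ spectrum ℂ T) :
    ∃ x : Fin n → ℂ, x ≠ 0 ∧ T *ᵥ x = z • x := by
  rw [← spectrum_toLin', ← Module.End.hasEigenvalue_iff_mem_spectrum] at hz
  obtain ⟨x, hx⟩ := hz.exists_hasEigenvector
  exact ⟨x, hx.2, hx.apply_eq_smul⟩

/-- A positive semidefinite solution is stabilizing if no eigenvector of `A` lies in the kernel
of `H`. -/
theorem spectralRadius_loop_lt_one {A G H X : Mat n} (hG : G.PosSemidef) (hH : H.PosSemidef)
    (hX : X.PosSemidef) (hfix : ric A G H X = X) (hAH : NoHiddenMode Aᴴ H) :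
    spectralRadius ℂ (loop A G X) < 1 := by
  refine spectralRadius_lt_one fun z hz => ?_
  by_contra! hz1
  obtain ⟨x, hx0, hx⟩ := exists_eigenvector hz
  obtain ⟨hGX, hHx⟩ := mulVec_eq_zero_of_eigen hG hH hX hfix hz1 (x := x)
    (by rw [hx, mulVec_smul])
  refine hx0 (hAH x z ?_ hHx)
  have hA : A = (1 + G * X) * loop A G X := by
    rw [loop, ← Matrix.mul_assoc, mul_nonsing_inv _ (isUnit_det_of_posSemidef hG hX), Matrix.one_mul]
  rw [conjTranspose_conjTranspose]
  conv_lhs => rw [hA]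
  rw [← mulVec_mulVec, hx, mulVec_smul, add_mulVec, ← mulVec_mulVec, hGX, one_mulVec, add_zero]

/-! ### Rates of convergence -/

lemma exists_conjTranspose_mul_self {X : Mat n} (hX : X.PosSemidef) : ∃ L : Mat n, X = Lᴴ * L :=
  CStarAlgebra.nonneg_iff_eq_star_mul_self.mp hX.nonneg

lemma mul_mul_le_smul {D N : Mat n} {b : ℝ} (hD : D.PosSemidef) (hN : N.PosSemidef)
    (hb : ‖N‖ * ‖D‖ ≤ b) : D * N * D ≤ b • D := by
  obtain ⟨L, rfl⟩ := exists_conjTranspose_mul_self hD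
  have hsa : IsSelfAdjoint (L * N * Lᴴ) := (hN.mul_mul_conjTranspose_same L).1
  have h1 : L * N * Lᴴ ≤ b • 1 := by
    refine hsa.le_algebraMap_norm_self.trans ?_
    rw [Algebra.algebraMap_eq_smul_one]
    refine smul_le_smul_of_nonneg_right ?_ PosSemidef.one.nonneg
    calc ‖L * N * Lᴴ‖ ≤ ‖L‖ * ‖N‖ * ‖Lᴴ‖ :=
          (norm_mul_le _ _).trans (mul_le_mul_of_nonneg_right (norm_mul_le _ _) (norm_nonneg _))
      _ = ‖N‖ * ‖Lᴴ * L‖ := by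
          rw [l2_opNorm_conjTranspose, l2_opNorm_conjTranspose_mul_self]; ring
      _ ≤ b := hb
  have h2 := conj_mono h1 L
  calc Lᴴ * L * N * (Lᴴ * L) = Lᴴ * (L * N * Lᴴ) * L := by noncomm_ring
    _ ≤ Lᴴ * (b • 1) * L := h2
    _ = b • (Lᴴ * L) := by simp

lemma norm_le_of_le_conj {D X T : Mat n} {b : ℝ} (hb : 0 ≤ b) (hD : 0 ≤ D) {L : Mat n}
    (hX : X = Lᴴ * L) (h : D ≤ b • (Tᴴ * X * T)) : ‖D‖ ≤ b * ‖L * T‖ ^ 2 := by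
  refine (CStarAlgebra.norm_le_norm_of_nonneg_of_le hD h).trans (le_of_eq ?_)
  have : Tᴴ * X * T = (L * T)ᴴ * (L * T) := by
    rw [hX, conjTranspose_mul]; noncomm_ring
  rw [norm_smul, this, l2_opNorm_conjTranspose_mul_self, Real.norm_of_nonneg hb, sq]

lemma exists_sq_lt {ρ : ℝ≥0∞} {s : ℝ} (h : ρ ^ 2 < ENNReal.ofReal s) :
    ∃ q : ℝ, 0 < q ∧ q ^ 2 < s ∧ ρ < ENNReal.ofReal q := by
  have hs : 0 < s := ENNReal.ofReal_pos.mp (bot_le.trans_lt h)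
  have h1 : ρ < ENNReal.ofReal (√s) := by
    rw [← Real.sq_sqrt hs.le, ENNReal.ofReal_pow (Real.sqrt_nonneg s)] at h
    exact lt_of_pow_lt_pow_left' 2 h
  obtain ⟨q, hq0, hq1, hq2⟩ := ENNReal.lt_iff_exists_real_btwn.mp h1
  have hqs := (ENNReal.ofReal_lt_ofReal_iff (Real.sqrt_pos.mpr hs)).mp hq2
  exact ⟨q, ENNReal.ofReal_pos.mp (bot_le.trans_lt hq1), (Real.lt_sqrt hq0).mp hqs, hq1⟩

lemma norm_lt_of_rhoD_lt {T : Mat n} {q : ℝ} (h : DARE.rhoD T < ENNReal.ofReal q)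
    {z : ℂ} (hz : z ∈ spectrum ℂ T) (hz1 : ‖z‖ < 1) : ‖z‖ < q := by
  have h1 : (‖z‖₊ : ℝ≥0∞) < ENNReal.ofReal q :=
    lt_of_le_of_lt (le_iSup₂ (f := fun z (_ : z ∈ spectrum ℂ T ∩ Metric.ball (0 : ℂ) 1) =>
      (‖z‖₊ : ℝ≥0∞)) z ⟨hz, mem_ball_zero_iff.mpr hz1⟩) h
  rw [← enorm_eq_nnnorm, ← ofReal_norm] at h1
  exact (ENNReal.ofReal_lt_ofReal_iff_of_nonneg (norm_nonneg z)).mp h1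

/-- Once `X - Y` is small, one step contracts it by the linearization up to a factor `b` close
to `1`. -/
lemma sub_ric_le_smul {A G H X Y : Mat n} {b : ℝ} (hG : G.PosSemidef) (hX : X.PosSemidef)
    (hY : Y.PosSemidef) (hYX : Y ≤ X) (hb : ‖G‖ * ‖X - Y‖ ≤ b - 1) :
    ric A G H X - ric A G H Y ≤ b • ((loop A G X)ᴴ * (X - Y) * loop A G X) := by
  rw [ric_sub_ric_quad hG.1 (adm_of_posSemidef hG hX) (adm_of_posSemidef hG hY)]
  have hD : (X - Y).PosSemidef := le_iff.mp hYX
  have hN := shunt_posSemidef hY hG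
  have hNG : ‖shunt Y G‖ ≤ ‖G‖ :=
    CStarAlgebra.norm_le_norm_of_nonneg_of_le hN.nonneg (shunt_le hY hG)
  have h1 := mul_mul_le_smul hD hN
    ((mul_le_mul_of_nonneg_right hNG (norm_nonneg _)).trans hb)
  have h2 : (X - Y) + (X - Y) * shunt Y G * (X - Y) ≤ b • (X - Y) := by
    calc _ ≤ (X - Y) + (b - 1) • (X - Y) := add_le_add_right h1 _
      _ = b • (X - Y) := by rw [sub_smul, one_smul]; abel
  refine (conj_mono h2 _).trans (le_of_eq ?_)
  simp

/-- The iteration started at `0` converges to its limit `X` faster than any `s ^ N` with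
`s > ρ_𝔻(T)²`, `T` the closed loop, if `X` kills the generalized eigenspaces of `T` for the
eigenvalues outside the open unit disk, so that these do not contribute. -/
theorem rate_of_iterate_zero {A G H X : Mat n} (hG : G.PosSemidef) (hH : H.PosSemidef)
    (hX : X.PosSemidef) (hfix : ric A G H X = X)
    (hkill : ∀ z ∈ spectrum ℂ (loop A G X), 1 ≤ ‖z‖ → ∀ (k : ℕ) (x : Fin n → ℂ),
      (loop A G X - z • 1) ^ k *ᵥ x = 0 → X *ᵥ x = 0)
    (hle : ∀ j, (ric A G H)^[j] 0 ≤ X)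
    (ht : Tendsto (fun j => (ric A G H)^[j] 0) atTop (𝓝 X)) {s : ℝ}
    (hs : DARE.rhoD (loop A G X) ^ 2 < ENNReal.ofReal s) :
    ∃ c : ℝ, ∀ᶠ N in atTop, ‖(ric A G H)^[N] 0 - X‖ ≤ c * s ^ N := by
  obtain ⟨q, hq, hqs, hTq⟩ := exists_sq_lt hs
  have hs0 : 0 < s := (by positivity : 0 < q ^ 2).trans hqs
  have hpsd := fun j => iterate_ric_posSemidef (A := A) hG hH PosSemidef.zero j
  set u := fun j => (ric A G H)^[j] 0
  set T := loop A G X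
  set b := s / q ^ 2
  have hb : 1 < b := (one_lt_div (by positivity)).mpr hqs
  have hsmall : Tendsto (fun j => ‖G‖ * ‖X - u j‖) atTop (𝓝 0) := by
    have := ((ht.const_sub X).norm).const_mul ‖G‖
    simpa using this
  obtain ⟨j₀, hj₀⟩ := eventually_atTop.mp (hsmall.eventually_le_const (sub_pos.mpr hb))
  have hiter : ∀ i, X - u (i + j₀) ≤ b ^ i • ((T ^ i)ᴴ * X * T ^ i) := by
    intro i
    induction i with
    | zero => simpa using (hpsd j₀).nonneg
    | succ i ih =>
      have h1 := sub_ric_le_smul (A := A) (H := H) hG hX (hpsd (i + j₀)) (hle _)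
        (hj₀ (i + j₀) (Nat.le_add_left _ _))
      rw [hfix, ← Function.iterate_succ_apply' (ric A G H), ← Nat.succ_add] at h1
      refine h1.trans ((smul_le_smul_of_nonneg_left (conj_mono ih T) (by positivity)).trans ?_)
      rw [mul_smul_comm, smul_mul_assoc, smul_smul, ← pow_succ', pow_succ T, conjTranspose_mul]
      exact le_of_eq (by noncomm_ring)
  obtain ⟨L, hL⟩ := exists_conjTranspose_mul_self hX
  obtain ⟨c, hc⟩ := exists_norm_mul_pow_le (L := L) (T := T) (q := q) fun z hz => by
    rcases lt_or_ge ‖z‖ 1 with h | h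
    · exact Or.inl (norm_lt_of_rhoD_lt hTq hz h)
    · refine Or.inr fun k x hx => ?_
      have h1 := hkill z hz h k x hx
      rw [hL, conjTranspose_mul_self_mulVec_eq_zero] at h1
      exact h1
  refine ⟨c ^ 2 / s ^ j₀, eventually_atTop.mpr ⟨j₀, fun N hN => ?_⟩⟩
  obtain ⟨i, rfl⟩ := Nat.exists_eq_add_of_le' hN
  have h1 := norm_le_of_le_conj (by positivity) (sub_nonneg.mpr (hle (i + j₀))) hL (hiter i)
  rw [norm_sub_rev]
  calc ‖X - u (i + j₀)‖ ≤ b ^ i * ‖L * T ^ i‖ ^ 2 := h1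
    _ ≤ b ^ i * (c * q ^ i) ^ 2 := by
      have := hc i
      gcongr
    _ = c ^ 2 * (b * q ^ 2) ^ i := by ring
    _ = c ^ 2 * s ^ i := by rw [div_mul_cancel₀ _ (by positivity)]
    _ = c ^ 2 / s ^ j₀ * s ^ (i + j₀) := by
      rw [pow_add]; field_simp

/-- From above, concavity bounds the error `E_N` by `(T ^ N)ᴴ E_0 T ^ N`, without any loss. -/
theorem rate_of_iterate_of_le {A G H X X₀ : Mat n} (hG : G.PosSemidef) (hH : H.PosSemidef)
    (hX : X.PosSemidef) (hfix : ric A G H X = X) (hle : X ≤ X₀) {s : ℝ}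
    (hs : spectralRadius ℂ (loop A G X) ^ 2 < ENNReal.ofReal s) :
    ∃ c : ℝ, ∀ᶠ N in atTop, ‖(ric A G H)^[N] X₀ - X‖ ≤ c * s ^ N := by
  obtain ⟨q, hq, hqs, hTq⟩ := exists_sq_lt hs
  have hX₀ : X₀.PosSemidef := (hX.nonneg.trans hle).posSemidef
  have hpsd := fun j => iterate_ric_posSemidef (A := A) hG hH hX₀ j
  have hge := le_iterate_of_fixed hG hX hfix hle
  obtain ⟨c, hc⟩ := exists_norm_pow_le hTq
  obtain ⟨L, hL⟩ := exists_conjTranspose_mul_self (le_iff.mp hle)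
  set T := loop A G X
  have hiter : ∀ i, (ric A G H)^[i] X₀ - X ≤ (1 : ℝ) • ((T ^ i)ᴴ * (X₀ - X) * T ^ i) := by
    intro i
    rw [one_smul]
    induction i with
    | zero => simp
    | succ i ih =>
      have h1 := ric_sub_ric_le (A := A) (H := H) hG (adm_of_posSemidef hG hX) (hpsd i)
      rw [hfix, ← Function.iterate_succ_apply' (ric A G H)] at h1
      refine h1.trans ((conj_mono ih T).trans (le_of_eq ?_))
      rw [pow_succ T, conjTranspose_mul]
      noncomm_ring
  refine ⟨‖L‖ ^ 2 * c ^ 2, Eventually.of_forall fun i => ?_⟩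
  have h1 := norm_le_of_le_conj zero_le_one (sub_nonneg.mpr (hge i)) hL (hiter i)
  calc _ ≤ 1 * ‖L * T ^ i‖ ^ 2 := h1
    _ ≤ 1 * (‖L‖ * (c * q ^ i)) ^ 2 := by
      have := (norm_mul_le L (T ^ i)).trans (mul_le_mul_of_nonneg_left (hc i) (norm_nonneg L))
      gcongr
    _ = ‖L‖ ^ 2 * c ^ 2 * (q ^ 2) ^ i := by ring
    _ ≤ ‖L‖ ^ 2 * c ^ 2 * s ^ i := by gcongr

lemma rpow_inv_bound {r : ℕ} (hr : 1 < r) {c s : ℝ} (hc : 0 < c) (hs : 0 < s) :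
    Tendsto (fun k : ℕ => (c * s ^ r ^ k) ^ (1 / (r : ℝ) ^ k)) atTop (𝓝 s) := by
  have h0 : Tendsto (fun k : ℕ => 1 / (r : ℝ) ^ k) atTop (𝓝 0) := by
    simpa only [one_div, Function.comp_def] using tendsto_inv_atTop_zero.comp
      (tendsto_pow_atTop_atTop_of_one_lt (by exact_mod_cast hr : (1 : ℝ) < r))
  have h1 : Tendsto (fun k : ℕ => c ^ (1 / (r : ℝ) ^ k) * s) atTop (𝓝 (c ^ (0 : ℝ) * s)) :=
    ((Real.continuousAt_const_rpow hc.ne').tendsto.comp h0).mul_const s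
  rw [Real.rpow_zero, one_mul] at h1
  refine h1.congr fun k => ?_
  rw [Real.mul_rpow hc.le (by positivity)]
  congr 1
  have : r ^ k ≠ 0 := pow_ne_zero _ (by omega)
  rw [one_div, ← Nat.cast_pow, Real.pow_rpow_inv_natCast hs.le this]

/-- Sampling a linearly convergent sequence at the times `r ^ k` gives convergence of order `r`. -/
theorem rootLimsup_le {r : ℕ} (hr : 1 < r) {u v : ℕ → Mat n} {X : Mat n} {ρ : ℝ≥0∞}
    (hv : ∀ᶠ k in atTop, v k = u (r ^ k))
    (h : ∀ s : ℝ, ρ ^ 2 < ENNReal.ofReal s → ∃ c : ℝ, ∀ᶠ N in atTop, ‖u N - X‖ ≤ c * s ^ N) :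
    DARE.rootLimsup r v X ≤ ρ ^ 2 := by
  refine le_of_forall_gt fun b hb => ?_
  obtain ⟨s, hs0, hs1, hs2⟩ := ENNReal.lt_iff_exists_real_btwn.mp hb
  have hs : 0 < s := ENNReal.ofReal_pos.mp (bot_le.trans_lt hs1)
  obtain ⟨c, hc⟩ := h s hs1
  refine lt_of_le_of_lt ?_ hs2
  have hlim := ENNReal.tendsto_ofReal (rpow_inv_bound hr (lt_max_of_lt_right one_pos :
    0 < max c 1) hs)
  rw [← hlim.limsup_eq, DARE.rootLimsup]
  refine limsup_le_limsup ?_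
  have hrk : Tendsto (fun k => r ^ k) atTop atTop := tendsto_pow_atTop_atTop_of_one_lt hr
  filter_upwards [hv, hrk.eventually hc] with k hk hck
  refine ENNReal.ofReal_le_ofReal (Real.rpow_le_rpow (norm_nonneg _) ?_ (by positivity))
  rw [hk]
  exact hck.trans (by gcongr; exact le_max_left _ _)

lemma rSuperlinear_of_rootLimsup_le {r : ℕ} {v : ℕ → Mat n} {X : Mat n} {ρ : ℝ≥0∞}
    (hρ : ρ < 1) (h : DARE.rootLimsup r v X ≤ ρ) : DARE.RSuperlinear r v X := by
  obtain ⟨s, hs0, hs1, hs2⟩ := ENNReal.lt_iff_exists_real_btwn.mp hρ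
  refine ⟨s, ENNReal.ofReal_pos.mp (bot_le.trans_lt hs1), ?_, h.trans hs1.le⟩
  rw [← ENNReal.ofReal_one] at hs2
  exact (ENNReal.ofReal_lt_ofReal_iff one_pos).mp hs2

end Norm

/-! ### The accelerated iteration as composition of Riccati operators -/

/-- The triple `Q` represents the `N`-fold iterates of the Riccati operator of `(A, G, H)` and of
its dual. -/
structure Represents (A G H : Mat n) (Q : DARE.Triple n) (N : ℕ) : Prop where
  posG : Q.G.PosSemidef
  posH : Q.H.PosSemidef
  primal : ∀ X : Mat n, X.PosSemidef → ric Q.A Q.G Q.H X = (ric A G H)^[N] X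
  dual : ∀ Y : Mat n, Y.PosSemidef → ric Q.Aᴴ Q.H Q.G Y = (ric Aᴴ H G)^[N] Y

/-- The triple of the dual equation. -/
def dualTriple (Q : DARE.Triple n) : DARE.Triple n := ⟨Q.Aᴴ, Q.H, Q.G⟩

lemma innerStep_H (P Q : DARE.Triple n) :
    (DARE.innerStep P Q).H = ric P.A P.G P.H Q.H := by
  simp only [DARE.innerStep, ric, shunt]
  noncomm_ring

lemma innerStep_G {P Q : DARE.Triple n} (hP : P.G.PosSemidef) (hQ : Q.H.PosSemidef) :
    (DARE.innerStep P Q).G = ric Q.Aᴴ Q.H Q.G P.G := by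
  simp only [DARE.innerStep, ric, ← inv_one_add_mul (isUnit_det_of_posSemidef hP hQ),
    conjTranspose_conjTranspose]
  noncomm_ring

lemma dualTriple_innerStep {P Q : DARE.Triple n} (hP : P.G.PosSemidef) (hQ : Q.H.PosSemidef) :
    dualTriple (DARE.innerStep P Q) = DARE.innerStep (dualTriple Q) (dualTriple P) := by
  have h1 := innerStep_G hP hQ
  have h2 := innerStep_H P Q
  have h3 := innerStep_G (P := dualTriple Q) (Q := dualTriple P) hQ hP
  have h4 := innerStep_H (dualTriple Q) (dualTriple P)
  have hA : (DARE.innerStep P Q).Aᴴ = (DARE.innerStep (dualTriple Q) (dualTriple P)).A := by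
    simp only [DARE.innerStep, dualTriple, conjTranspose_mul,
      conjTranspose_inv_one_add hP.1 hQ.1, Matrix.mul_assoc]
  simp only [dualTriple, conjTranspose_conjTranspose] at h3 h4 hA
  rw [dualTriple, hA, h1, h2]
  simp only [dualTriple] at *
  rw [← h3, ← h4]

/-- An inner pass composes the Riccati operators of the two triples. -/
theorem ric_innerStep {P Q : DARE.Triple n} (hPG : P.G.PosSemidef)
    (hQG : Q.G.PosSemidef) (hQH : Q.H.PosSemidef) {X : Mat n} (hX : X.PosSemidef) :
    ric (DARE.innerStep P Q).A (DARE.innerStep P Q).G (DARE.innerStep P Q).H X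
      = ric P.A P.G P.H (ric Q.A Q.G Q.H X) := by
  have hM : (ric Q.A Q.G Q.H X).PosSemidef := ric_posSemidef hQG hQH hX
  have hPQG : (DARE.innerStep P Q).G.PosSemidef := by
    rw [innerStep_G hPG hQH]
    exact ric_posSemidef hQH hQG hPG
  have hsub := ric_sub_ric (A := P.A) (H := P.H) hPG.1 (adm_of_posSemidef hPG hQH)
    (adm_of_posSemidef hPG hM)
  have hMH : Q.H - ric Q.A Q.G Q.H X = -(Q.Aᴴ * shunt Q.G X * Q.A) := by rw [ric]; abel
  -- the factor `(1 + G X)⁻¹` of the composite triple, before clearing denominators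
  have hkey : (1 + Q.G * X)⁻¹ * Q.A * (1 + P.G * ric Q.A Q.G Q.H X)⁻¹
      = (1 + (DARE.innerStep P Q).G * X)⁻¹ * (Q.A * (1 + P.G * Q.H)⁻¹) := by
    have u1 := mul_nonsing_inv _ (isUnit_det_of_posSemidef hQG hX)
    have u2 := mul_nonsing_inv _ (isUnit_det_of_posSemidef hPG hM)
    have u3 := nonsing_inv_mul _ (isUnit_det_of_posSemidef hPQG hX)
    have u4 := nonsing_inv_mul _ (isUnit_det_of_posSemidef hPG hQH)
    have e : (1 + (DARE.innerStep P Q).G * X) * ((1 + Q.G * X)⁻¹ * Q.A)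
        = Q.A * (1 + P.G * Q.H)⁻¹ * (1 + P.G * ric Q.A Q.G Q.H X) := by
      simp only [ric, shunt, DARE.innerStep]
      generalize (1 + Q.G * X)⁻¹ = U at *
      generalize (1 + P.G * Q.H)⁻¹ = V at *
      calc _ = ((1 + Q.G * X) * U) * Q.A + Q.A * V * P.G * Q.Aᴴ * X * U * Q.A := by noncomm_ring
        _ = Q.A * (V * (1 + P.G * Q.H)) + Q.A * V * P.G * Q.Aᴴ * X * U * Q.A := by
          rw [u1, u4]; simp
        _ = _ := by noncomm_ring
    generalize (1 + (DARE.innerStep P Q).G * X)⁻¹ = W at *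
    generalize (1 + P.G * ric Q.A Q.G Q.H X)⁻¹ = Z at *
    calc (1 + Q.G * X)⁻¹ * Q.A * Z
        = (W * (1 + (DARE.innerStep P Q).G * X)) * ((1 + Q.G * X)⁻¹ * Q.A) * Z := by
          rw [u3, Matrix.one_mul]
      _ = W * ((1 + (DARE.innerStep P Q).G * X) * ((1 + Q.G * X)⁻¹ * Q.A)) * Z := by
          noncomm_ring
      _ = W * (Q.A * (1 + P.G * Q.H)⁻¹) * ((1 + P.G * ric Q.A Q.G Q.H X) * Z) := by
          rw [e]; noncomm_ring
      _ = _ := by rw [u2, Matrix.mul_one]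
  have hA : (DARE.innerStep P Q).A = Q.A * loop P.A P.G Q.H := by
    simp only [DARE.innerStep, loop]; noncomm_ring
  calc ric (DARE.innerStep P Q).A (DARE.innerStep P Q).G (DARE.innerStep P Q).H X
      = (DARE.innerStep P Q).Aᴴ * (X * ((1 + (DARE.innerStep P Q).G * X)⁻¹ *
          (Q.A * (1 + P.G * Q.H)⁻¹))) * P.A + ric P.A P.G P.H Q.H := by
        rw [ric, innerStep_H, shunt]
        congr 1
        conv_lhs => rw [show (DARE.innerStep P Q).A = Q.A * (1 + P.G * Q.H)⁻¹ * P.A from rfl]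
        conv_rhs => rw [show (DARE.innerStep P Q).A = Q.A * (1 + P.G * Q.H)⁻¹ * P.A from rfl]
        noncomm_ring
    _ = ric P.A P.G P.H Q.H + (loop P.A P.G Q.H)ᴴ * (Q.Aᴴ * shunt Q.G X * Q.A) *
          loop P.A P.G (ric Q.A Q.G Q.H X) := by
        rw [← hkey, hA, conjTranspose_mul, loop, loop, shunt]
        noncomm_ring
    _ = _ := by
        have : ric P.A P.G P.H (ric Q.A Q.G Q.H X) = ric P.A P.G P.H Q.H -
          (ric P.A P.G P.H Q.H - ric P.A P.G P.H (ric Q.A Q.G Q.H X)) := by abel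
        rw [this, hsub, hMH]
        noncomm_ring

lemma Represents.innerStep {A G H : Mat n} (hG : G.PosSemidef) (hH : H.PosSemidef)
    {P Q : DARE.Triple n} {p q : ℕ}
    (hP : Represents A G H P p) (hQ : Represents A G H Q q) :
    Represents A G H (DARE.innerStep P Q) (p + q) where
  posG := by
    rw [innerStep_G hP.posG hQ.posH]
    exact ric_posSemidef hQ.posH hQ.posG hP.posG
  posH := by
    rw [innerStep_H]
    exact ric_posSemidef hP.posG hP.posH hQ.posH
  primal X hX := by
    rw [ric_innerStep hP.posG hQ.posG hQ.posH hX, hQ.primal X hX,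
      hP.primal _ (iterate_ric_posSemidef hG hH hX q), Function.iterate_add_apply]
  dual Y hY := by
    have h := ric_innerStep (P := dualTriple Q) (Q := dualTriple P) hQ.posH hP.posH hP.posG hY
    rw [← dualTriple_innerStep hP.posG hQ.posH] at h
    simp only [dualTriple] at h
    rw [h, hP.dual Y hY, hQ.dual _ (iterate_ric_posSemidef hH hG hY p), add_comm,
      Function.iterate_add_apply]

lemma Represents.one {A G H : Mat n} (hG : G.PosSemidef) (hH : H.PosSemidef) :
    Represents A G H ⟨A, G, H⟩ 1 := ⟨hG, hH, fun _ _ => rfl, fun _ _ => rfl⟩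

lemma Represents.zero (A G H : Mat n) : Represents A G H ⟨1, 0, 0⟩ 0 :=
  ⟨PosSemidef.zero, PosSemidef.zero, fun _ _ => by simp [ric], fun _ _ => by simp [ric]⟩

lemma Represents.inner {A G H : Mat n} (hG : G.PosSemidef) (hH : H.PosSemidef)
    {P : DARE.Triple n} {p : ℕ} (hP : Represents A G H P p) (j : ℕ) :
    Represents A G H (DARE.inner P j) (p * (j + 1)) := by
  induction j with
  | zero => simpa [DARE.inner] using hP
  | succ j ih =>
    rw [show p * (j + 1 + 1) = p + p * (j + 1) by ring]
    exact hP.innerStep hG hH ih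

lemma Represents.afpi {A G H : Mat n} (hG : G.PosSemidef) (hH : H.PosSemidef) {r : ℕ}
    (hr : 1 < r) (k : ℕ) : Represents A G H (DARE.afpi r ⟨A, G, H⟩ k) (r ^ k) := by
  induction k with
  | zero => exact Represents.one hG hH
  | succ k ih =>
    have := ih.inner hG hH (r - 1)
    rwa [Nat.sub_add_cancel hr.le, ← pow_succ] at this

lemma Represents.G_eq {A G H : Mat n} {Q : DARE.Triple n} {N : ℕ} (h : Represents A G H Q N) :
    Q.G = (ric Aᴴ H G)^[N] 0 := by
  rw [← h.dual 0 PosSemidef.zero, ric_zero]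

lemma Represents.H_eq {A G H : Mat n} {Q : DARE.Triple n} {N : ℕ} (h : Represents A G H Q N) :
    Q.H = (ric A G H)^[N] 0 := by
  rw [← h.primal 0 PosSemidef.zero, ric_zero]

lemma exists_represents {A G H : Mat n} (hG : G.PosSemidef) (hH : H.PosSemidef) (N : ℕ) :
    ∃ Q, Represents A G H Q N := by
  induction N with
  | zero => exact ⟨_, Represents.zero A G H⟩
  | succ N ih =>
    obtain ⟨Q, hQ⟩ := ih
    exact ⟨_, add_comm N 1 ▸ (Represents.one hG hH).innerStep hG hH hQ⟩

/-- If some dual iterate `G_N` of `0` is positive definite, then the `N`-fold Riccati operator is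
bounded above by `A_Nᴴ G_N⁻¹ A_N + H_N` on all positive semidefinite matrices. -/
theorem exists_iterate_le {A G H : Mat n} (hG : G.PosSemidef) (hH : H.PosSemidef) {N : ℕ}
    (hN : ((ric Aᴴ H G)^[N] 0).PosDef) : ∃ M : Mat n, ∀ j, (ric A G H)^[j] 0 ≤ M := by
  obtain ⟨Q, hQ⟩ := exists_represents (A := A) hG hH N
  rw [← hQ.G_eq] at hN
  refine ⟨Q.Aᴴ * Q.G⁻¹ * Q.A + Q.H, fun j => ?_⟩
  have hpsd := fun j => iterate_ric_posSemidef (A := A) hG hH PosSemidef.zero j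
  calc (ric A G H)^[j] 0 ≤ (ric A G H)^[j] ((ric A G H)^[N] 0) :=
        iterate_ric_mono hG hH PosSemidef.zero (hpsd N).nonneg j
    _ = ric Q.A Q.G Q.H ((ric A G H)^[j] 0) := by
        rw [hQ.primal _ (hpsd j), ← Function.iterate_add_apply, ← Function.iterate_add_apply,
          add_comm]
    _ ≤ _ := add_le_add_left (conj_mono (shunt_le_inv hN (hpsd j)) Q.A) Q.H

/-! ### Controllability -/

lemma gMat_posSemidef (B : Matrix (Fin n) (Fin m) ℂ) {R : Mat m} (hR : R.PosDef) :
    (DARE.gMat B R).PosSemidef :=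
  hR.inv.posSemidef.mul_mul_conjTranspose_same B

lemma hMat_posSemidef (C : Matrix (Fin l) (Fin n) ℂ) : (DARE.hMat C).PosSemidef :=
  posSemidef_conjTranspose_mul_self C

lemma gMat_mulVec_eq_zero {B : Matrix (Fin n) (Fin m) ℂ} {R : Mat m} (hR : R.PosDef)
    {y : Fin n → ℂ} (h : DARE.gMat B R *ᵥ y = 0) : Bᴴ *ᵥ y = 0 := by
  by_contra hy
  have h1 := hR.inv.dotProduct_mulVec_pos hy
  rw [star_mulVec, conjTranspose_conjTranspose, ← dotProduct_mulVec, mulVec_mulVec,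
    mulVec_mulVec] at h1
  rw [DARE.gMat] at h
  rw [h, dotProduct_zero] at h1
  exact h1.false

lemma eq_zero_of_controllable {A : Mat n} {B : Matrix (Fin n) (Fin m) ℂ}
    (hAB : DARE.Controllable A B) {y : Fin n → ℂ}
    (h : ∀ i < n, Bᴴ *ᵥ ((Aᴴ) ^ i *ᵥ y) = 0) : y = 0 := by
  rw [DARE.Controllable, ← rank_conjTranspose] at hAB
  set K := (Matrix.of fun (i : Fin n) (p : Fin n × Fin m) => (A ^ (p.1 : ℕ) * B) i p.2)
  have hker : Module.finrank ℂ (LinearMap.ker Kᴴ.mulVecLin) = 0 := by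
    have := LinearMap.finrank_range_add_finrank_ker Kᴴ.mulVecLin
    rw [← Matrix.rank, hAB, Module.finrank_fin_fun] at this
    omega
  have hmem : y ∈ LinearMap.ker Kᴴ.mulVecLin := by
    rw [LinearMap.mem_ker, mulVecLin_apply]
    ext ⟨i, b⟩
    have := congrFun (h i i.2) b
    rw [mulVec_mulVec, ← conjTranspose_pow, ← conjTranspose_mul] at this
    exact this
  rw [Submodule.finrank_eq_zero.mp hker] at hmem
  exact (Submodule.mem_bot ℂ).mp hmem

lemma noHiddenMode_of_controllable {A : Mat n} {B : Matrix (Fin n) (Fin m) ℂ} {R : Mat m}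
    (hR : R.PosDef) (hAB : DARE.Controllable A B) : NoHiddenMode A (DARE.gMat B R) := by
  intro y z hy hGy
  have hB := gMat_mulVec_eq_zero hR hGy
  refine eq_zero_of_controllable hAB fun i _ => ?_
  have : (Aᴴ) ^ i *ᵥ y = z ^ i • y := by
    induction i with
    | zero => simp
    | succ i ih =>
      rw [pow_succ, ← mulVec_mulVec, hy, mulVec_smul, ih (by omega), smul_smul, pow_succ']
  rw [this, mulVec_smul, hB, smul_zero]

/-- Vectors killed by the `j`-th dual iterate are killed by `Bᴴ, Bᴴ Aᴴ, …, Bᴴ (Aᴴ)^(j-1)`. -/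
lemma mulVec_pow_eq_zero {A H : Mat n} {B : Matrix (Fin n) (Fin m) ℂ} {R : Mat m}
    (hR : R.PosDef) (hH : H.PosSemidef) (j : ℕ) : ∀ y : Fin n → ℂ,
    (ric Aᴴ H (DARE.gMat B R))^[j] 0 *ᵥ y = 0 → ∀ i < j, Bᴴ *ᵥ ((Aᴴ) ^ i *ᵥ y) = 0 := by
  have hG := gMat_posSemidef B hR
  induction j with
  | zero => intro y _ i hi; omega
  | succ j ih =>
    intro y hy i hi
    rw [Function.iterate_succ_apply'] at hy
    have hZ := iterate_ric_posSemidef (A := Aᴴ) hH hG PosSemidef.zero j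
    set Z := (ric Aᴴ H (DARE.gMat B R))^[j] 0
    have hS := shunt_posSemidef hH hZ
    have hq : star (Aᴴ *ᵥ y) ⬝ᵥ shunt H Z *ᵥ (Aᴴ *ᵥ y) + star y ⬝ᵥ DARE.gMat B R *ᵥ y = 0 := by
      rw [← star_dotProduct_conj, ← dotProduct_add, ← add_mulVec]
      rw [ric] at hy
      rw [hy, dotProduct_zero]
    obtain ⟨h1, h2⟩ := (add_eq_zero_iff_of_nonneg (quad_nonneg hS _)
      (quad_nonneg hG _)).mp hq
    rw [hS.dotProduct_mulVec_zero_iff] at h1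
    rw [hG.dotProduct_mulVec_zero_iff] at h2
    cases i with
    | zero => simpa using gMat_mulVec_eq_zero hR h2
    | succ i =>
      have hu := isUnit_det_of_posSemidef hH hZ
      rw [shunt_eq_inv_mul hu] at h1
      have h3 : Z *ᵥ (Aᴴ *ᵥ y) = 0 := by
        have := congrArg ((1 + Z * H) *ᵥ ·) h1
        simpa only [mulVec_mulVec, ← Matrix.mul_assoc, mul_nonsing_inv _ (isUnit_det_comm.mp hu),
          Matrix.one_mul, mulVec_zero] using this
      rw [pow_succ, ← mulVec_mulVec]
      exact ih _ h3 i (by omega)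

lemma posDef_of_mulVec {X : Mat n} (hX : X.PosSemidef)
    (h : ∀ y, X *ᵥ y = 0 → y = 0) : X.PosDef := by
  refine PosDef.of_dotProduct_mulVec_pos hX.1 fun y hy => lt_of_le_of_ne (quad_nonneg hX y) ?_
  intro h0
  exact hy (h y ((hX.dotProduct_mulVec_zero_iff y).mp h0.symm))

theorem posDef_iterate {A H : Mat n} {B : Matrix (Fin n) (Fin m) ℂ} {R : Mat m}
    (hR : R.PosDef) (hAB : DARE.Controllable A B) (hH : H.PosSemidef) :
    ((ric Aᴴ H (DARE.gMat B R))^[n] 0).PosDef :=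
  posDef_of_mulVec (iterate_ric_posSemidef hH (gMat_posSemidef B hR) PosSemidef.zero n)
    fun y hy => eq_zero_of_controllable hAB (mulVec_pow_eq_zero hR hH n y hy)

/-! ### Feedback form of the Riccati operator -/

lemma det_add_conj (B : Matrix (Fin n) (Fin m) ℂ) {R : Mat m} (hR : R.PosDef) (X : Mat n) :
    (R + Bᴴ * X * B).det = R.det * (1 + DARE.gMat B R * X).det := by
  have h : R + Bᴴ * X * B = R * (1 + (R⁻¹ * Bᴴ * X) * B) := by
    rw [Matrix.mul_add, Matrix.mul_one]
    simp only [← Matrix.mul_assoc]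
    rw [mul_nonsing_inv _ ((isUnit_iff_isUnit_det _).mp hR.isUnit), Matrix.one_mul]
  rw [h, det_mul, det_one_add_mul_comm, DARE.gMat]
  simp only [← Matrix.mul_assoc]

lemma mem_domR_iff {B : Matrix (Fin n) (Fin m) ℂ} {R : Mat m} (hR : R.PosDef) {X : Mat n} :
    X ∈ DARE.domR B R ↔ Adm (DARE.gMat B R) X := by
  have hd : R.det ≠ 0 := ((isUnit_iff_isUnit_det _).mp hR.isUnit).ne_zero
  rw [Adm, isUnit_iff_ne_zero]
  exact and_congr_right fun _ => by rw [det_add_conj B hR, mul_ne_zero_iff_left hd]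

lemma opR_eq (A : Mat n) (B : Matrix (Fin n) (Fin m) ℂ) (R : Mat m)
    (C : Matrix (Fin l) (Fin n) ℂ) (X : Mat n) :
    DARE.opR A B R C X = ric A (DARE.gMat B R) (DARE.hMat C) X := by
  simp only [DARE.opR, ric, shunt, Matrix.mul_assoc]

lemma opD_eq (A : Mat n) (B : Matrix (Fin n) (Fin m) ℂ) (R : Mat m)
    (C : Matrix (Fin l) (Fin n) ℂ) (Y : Mat n) :
    DARE.opD A B R C Y = ric Aᴴ (DARE.hMat C) (DARE.gMat B R) Y := by
  simp only [DARE.opD, ric, shunt, Matrix.mul_assoc, conjTranspose_conjTranspose]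

lemma mul_feedback {B : Matrix (Fin n) (Fin m) ℂ} {R : Mat m} (hR : R.PosDef) {X : Mat n}
    (hX : X ∈ DARE.domR B R) :
    B * (R + Bᴴ * X * B)⁻¹ * Bᴴ * X = 1 - (1 + DARE.gMat B R * X)⁻¹ := by
  have hu := ((mem_domR_iff hR).mp hX).2
  have hW : IsUnit (R + Bᴴ * X * B).det := isUnit_iff_ne_zero.mpr hX.2
  have hRu := (isUnit_iff_isUnit_det _).mp hR.isUnit
  have h1 : (1 + DARE.gMat B R * X) * B = B * R⁻¹ * (R + Bᴴ * X * B) := by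
    rw [Matrix.mul_add, Matrix.add_mul, Matrix.mul_assoc B, nonsing_inv_mul _ hRu, DARE.gMat]
    simp only [Matrix.mul_assoc, Matrix.one_mul, Matrix.mul_one]
  have h2 : (1 + DARE.gMat B R * X) * (B * (R + Bᴴ * X * B)⁻¹ * Bᴴ * X) = DARE.gMat B R * X := by
    simp only [← Matrix.mul_assoc]
    rw [h1, Matrix.mul_assoc (B * R⁻¹), mul_nonsing_inv _ hW, Matrix.mul_one, DARE.gMat]
  calc B * (R + Bᴴ * X * B)⁻¹ * Bᴴ * X
      = (1 + DARE.gMat B R * X)⁻¹ * ((1 + DARE.gMat B R * X) *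
          (B * (R + Bᴴ * X * B)⁻¹ * Bᴴ * X)) := by
        rw [← Matrix.mul_assoc _ (1 + DARE.gMat B R * X), nonsing_inv_mul _ hu, Matrix.one_mul]
    _ = (1 + DARE.gMat B R * X)⁻¹ * ((1 + DARE.gMat B R * X) - 1) := by rw [h2]; congr 1; abel
    _ = _ := by rw [Matrix.mul_sub, nonsing_inv_mul _ hu, Matrix.mul_one]

lemma clR_eq_loop {A : Mat n} {B : Matrix (Fin n) (Fin m) ℂ} {R : Mat m} (hR : R.PosDef)
    {X : Mat n} (hX : X ∈ DARE.domR B R) :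
    DARE.clR A B R X = loop A (DARE.gMat B R) X := by
  have h := mul_feedback hR hX
  rw [DARE.clR, DARE.fbR, loop]
  simp only [← Matrix.mul_assoc]
  rw [h, Matrix.sub_mul, Matrix.one_mul, sub_sub_cancel]

lemma shunt_gMat {B : Matrix (Fin n) (Fin m) ℂ} {R : Mat m} (hR : R.PosDef) {X : Mat n}
    (hX : X ∈ DARE.domR B R) :
    shunt (DARE.gMat B R) X = X - X * B * (R + Bᴴ * X * B)⁻¹ * Bᴴ * X := by
  have h : X * B * (R + Bᴴ * X * B)⁻¹ * Bᴴ * X = X * (B * (R + Bᴴ * X * B)⁻¹ * Bᴴ * X) := by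
    simp only [Matrix.mul_assoc]
  rw [h, mul_feedback hR hX, Matrix.mul_sub, Matrix.mul_one, sub_sub_cancel, shunt]

lemma psd_mem_domR {B : Matrix (Fin n) (Fin m) ℂ} {R : Mat m} (hR : R.PosDef) {X : Mat n}
    (hX : X.PosSemidef) : X ∈ DARE.domR B R :=
  (mem_domR_iff hR).mpr (adm_of_posSemidef (gMat_posSemidef B hR) hX)

/-- The Riccati operator is the optimal cost-to-go: any feedback matrix `F` gives an upper bound,
by completing the square. -/
theorem ric_le_feedback {A H : Mat n} {B : Matrix (Fin n) (Fin m) ℂ} {R : Mat m}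
    (hR : R.PosDef) {X : Mat n} (hX : X.PosSemidef) (F : Matrix (Fin m) (Fin n) ℂ) :
    ric A (DARE.gMat B R) H X ≤ (A - B * F)ᴴ * X * (A - B * F) + (H + Fᴴ * R * F) := by
  have hdom := psd_mem_domR (B := B) hR hX
  have hW : (R + Bᴴ * X * B).PosDef := hR.add_posSemidef (hX.conjTranspose_mul_mul_same B)
  have hWu : IsUnit (R + Bᴴ * X * B).det := isUnit_iff_ne_zero.mpr hdom.2
  set P := (R + Bᴴ * X * B)⁻¹ * (Bᴴ * X * A) with hP
  have hsq := hW.posSemidef.conjTranspose_mul_mul_same (F - P)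
  have h1 : (R + Bᴴ * X * B) * P = Bᴴ * X * A := by
    rw [hP, ← Matrix.mul_assoc, mul_nonsing_inv _ hWu, Matrix.one_mul]
  have h2 : Pᴴ * (R + Bᴴ * X * B) = Aᴴ * X * B := by
    have := congrArg conjTranspose h1
    simpa [conjTranspose_mul, hW.1.eq, hX.1.eq, hR.1.eq, Matrix.mul_assoc] using this
  have h3 : Aᴴ * (X * B * (R + Bᴴ * X * B)⁻¹ * Bᴴ * X) * A = Pᴴ * (Bᴴ * X * A) := by
    have : Aᴴ * (X * B * (R + Bᴴ * X * B)⁻¹ * Bᴴ * X) * A = Aᴴ * X * B * P := by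
      simp only [hP, Matrix.mul_assoc]
    rw [this, ← h2, Matrix.mul_assoc, h1]
  have hric : ric A (DARE.gMat B R) H X = Aᴴ * X * A - Pᴴ * (Bᴴ * X * A) + H := by
    rw [ric, shunt_gMat hR hdom, Matrix.mul_sub, Matrix.sub_mul, h3]
  have hexp : (F - P)ᴴ * (R + Bᴴ * X * B) * (F - P) =
      Fᴴ * (R + Bᴴ * X * B) * F - Aᴴ * X * B * F - (Fᴴ - Pᴴ) * (Bᴴ * X * A) := by
    rw [Matrix.mul_sub, Matrix.mul_assoc _ _ P, h1, conjTranspose_sub, Matrix.sub_mul, h2,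
      Matrix.sub_mul]
  rw [hexp] at hsq
  rw [le_iff, hric]
  suffices key : (A - B * F)ᴴ * X * (A - B * F) + (H + Fᴴ * R * F)
      - (Aᴴ * X * A - Pᴴ * (Bᴴ * X * A) + H)
      = Fᴴ * (R + Bᴴ * X * B) * F - Aᴴ * X * B * F - (Fᴴ - Pᴴ) * (Bᴴ * X * A) by
    rwa [key]
  simp only [conjTranspose_sub, conjTranspose_mul, Matrix.sub_mul, Matrix.mul_sub, Matrix.mul_add,
    Matrix.add_mul, Matrix.mul_assoc]
  abel

/-! ### Stein equations -/

/-- The Stein operator `D ↦ D - Tᴴ D T`. -/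
def stein (T : Mat n) : Mat n →ₗ[ℂ] Mat n :=
  LinearMap.id - (LinearMap.mulLeft ℂ Tᴴ).comp (LinearMap.mulRight ℂ T)

lemma stein_apply (T D : Mat n) : stein T D = D - Tᴴ * D * T := by
  simp [stein, Matrix.mul_assoc]

lemma stein_injective {T : Mat n} (hT : spectralRadius ℂ T < 1) :
    Function.Injective (stein T) := by
  rw [← LinearMap.ker_eq_bot, LinearMap.ker_eq_bot']
  intro D hD
  rw [stein_apply, sub_eq_zero] at hD
  exact eq_zero_of_eq_conj hT.le hT hD

lemma exists_stein {T Q : Mat n} (hT : spectralRadius ℂ T < 1) (hQ : Q.PosSemidef) :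
    ∃ X : Mat n, X.PosSemidef ∧ X - Tᴴ * X * T = Q := by
  obtain ⟨X, hX⟩ := LinearMap.injective_iff_surjective.mp (stein_injective hT) Q
  rw [stein_apply] at hX
  refine ⟨X, (nonneg_of_conj_le hT ?_).posSemidef, hX⟩
  rw [← sub_nonneg, hX]
  exact hQ.nonneg

/-! ### Spectra of inverses -/

lemma mem_spectrum_inv {T : Mat n} (hT : IsUnit T) {z : ℂ} :
    z ∈ spectrum ℂ T⁻¹ ↔ z⁻¹ ∈ spectrum ℂ T := by
  obtain ⟨u, rfl⟩ := hT
  rw [← coe_units_inv, ← spectrum.map_inv, Set.mem_inv]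

lemma one_le_mu_iff {T : Mat n} : 1 ≤ DARE.mu T ↔ ∀ z ∈ spectrum ℂ T, 1 ≤ ‖z‖ := by
  rw [DARE.mu, le_iInf₂_iff]
  exact forall₂_congr fun z _ => by
    rw [← ENNReal.coe_one, ENNReal.coe_le_coe, ← NNReal.coe_le_coe]; rfl

lemma isUnit_of_one_le_mu {T : Mat n} (h : 1 ≤ DARE.mu T) : IsUnit T := by
  by_contra hT
  have := one_le_mu_iff.mp h 0 (spectrum.zero_mem_iff ℂ |>.mpr hT)
  norm_num at this

lemma spectralRadius_inv_le_one {T : Mat n} (h : 1 ≤ DARE.mu T) :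
    spectralRadius ℂ T⁻¹ ≤ 1 := by
  refine iSup₂_le fun z hz => ?_
  have h1 := one_le_mu_iff.mp h _ ((mem_spectrum_inv (isUnit_of_one_le_mu h)).mp hz)
  rw [norm_inv] at h1
  have h2 : ‖z‖ ≤ 1 := by
    by_contra! h3
    exact absurd h1 (not_le.mpr (inv_lt_one_of_one_lt₀ h3))
  exact_mod_cast h2

lemma one_le_mu_of_inv {T : Mat n} (hT : IsUnit T) (h : spectralRadius ℂ T⁻¹ < 1) :
    1 ≤ DARE.mu T := by
  refine one_le_mu_iff.mpr fun z hz => ?_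
  have h0 : z ≠ 0 := by
    rintro rfl
    exact (spectrum.zero_mem_iff ℂ).mp hz hT
  have h1 : z⁻¹ ∈ spectrum ℂ T⁻¹ := by rwa [mem_spectrum_inv hT, inv_inv]
  have h2 := norm_lt_of_spectralRadius_lt (by rwa [ENNReal.ofReal_one]) h1
  rw [norm_inv] at h2
  exact ((inv_lt_one₀ (norm_pos_iff.mpr h0)).mp h2).le

/-! ### The antistabilizing solution `-Y⁻¹` -/

section Antistabilizing

variable {A G H Y : Mat n}

lemma isUnit_loop_dual (hA : IsUnit A) (hH : H.PosSemidef) (hY : Y.PosDef) :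
    IsUnit (loop Aᴴ H Y) := by
  have h1 : IsUnit (1 + H * Y) :=
    (isUnit_iff_isUnit_det _).mpr (isUnit_det_of_posSemidef hH hY.posSemidef)
  exact ((isUnit_nonsing_inv_iff).mpr h1).mul ((isUnit_star (a := A)).mpr hA)

lemma one_sub_mul_inv (hY : Y.PosDef) (hfix : ric Aᴴ H G Y = Y) :
    1 + G * -Y⁻¹ = A * Y * loop Aᴴ H Y * Y⁻¹ := by
  have hYu := mul_nonsing_inv _ ((isUnit_iff_isUnit_det _).mp hY.isUnit)
  have h1 : Y - G = A * Y * loop Aᴴ H Y := by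
    have := ric_eq_mul_loop (A := Aᴴ) (G := H) (H := G) (X := Y)
    rw [hfix, conjTranspose_conjTranspose] at this
    exact sub_eq_of_eq_add this
  rw [← h1, Matrix.sub_mul, hYu, Matrix.mul_neg, sub_eq_add_neg]

lemma isUnit_one_sub (hA : IsUnit A) (hH : H.PosSemidef) (hY : Y.PosDef)
    (hfix : ric Aᴴ H G Y = Y) : IsUnit (1 + G * -Y⁻¹) := by
  rw [one_sub_mul_inv hY hfix]
  exact ((hA.mul hY.isUnit).mul (isUnit_loop_dual hA hH hY)).mul
    (isUnit_nonsing_inv_iff.mpr hY.isUnit)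

lemma adm_neg_inv (hA : IsUnit A) (hH : H.PosSemidef) (hY : Y.PosDef)
    (hfix : ric Aᴴ H G Y = Y) : Adm G (-Y⁻¹) :=
  ⟨hY.inv.1.neg, (isUnit_iff_isUnit_det _).mp (isUnit_one_sub hA hH hY hfix)⟩

/-- The closed loop at `-Y⁻¹` is similar to the inverse of the dual closed loop at `Y`. -/
lemma loop_neg_inv (hA : IsUnit A) (hY : Y.PosDef) (hfix : ric Aᴴ H G Y = Y) :
    loop A G (-Y⁻¹) = Y * (loop Aᴴ H Y)⁻¹ * Y⁻¹ := by
  have hAu := nonsing_inv_mul _ ((isUnit_iff_isUnit_det _).mp hA)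
  rw [loop, one_sub_mul_inv hY hfix]
  simp only [Matrix.mul_inv_rev, nonsing_inv_nonsing_inv _ ((isUnit_iff_isUnit_det _).mp hY.isUnit),
    Matrix.mul_assoc, hAu, Matrix.mul_one]

lemma loop_neg_inv_inv (hA : IsUnit A) (hH : H.PosSemidef) (hY : Y.PosDef)
    (hfix : ric Aᴴ H G Y = Y) : (loop A G (-Y⁻¹))⁻¹ = Y * loop Aᴴ H Y * Y⁻¹ := by
  rw [loop_neg_inv hA hY hfix]
  simp only [Matrix.mul_inv_rev, nonsing_inv_nonsing_inv _ ((isUnit_iff_isUnit_det _).mp hY.isUnit),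
    nonsing_inv_nonsing_inv _ ((isUnit_iff_isUnit_det _).mp (isUnit_loop_dual hA hH hY)),
    Matrix.mul_assoc]

lemma isUnit_loop_neg_inv (hA : IsUnit A) (hH : H.PosSemidef) (hY : Y.PosDef)
    (hfix : ric Aᴴ H G Y = Y) : IsUnit (loop A G (-Y⁻¹)) :=
  (isUnit_nonsing_inv_iff.mpr (isUnit_one_sub hA hH hY hfix)).mul hA

lemma spectrum_loop_neg_inv_inv (hA : IsUnit A) (hH : H.PosSemidef) (hY : Y.PosDef)
    (hfix : ric Aᴴ H G Y = Y) :
    spectrum ℂ (loop A G (-Y⁻¹))⁻¹ = spectrum ℂ (loop Aᴴ H Y) := by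
  rw [loop_neg_inv_inv hA hH hY hfix]
  obtain ⟨u, hu⟩ := hY.isUnit
  rw [← hu, ← coe_units_inv, spectrum.units_conjugate]

lemma ric_neg_inv (hA : IsUnit A) (hH : H.PosSemidef) (hY : Y.PosDef)
    (hfix : ric Aᴴ H G Y = Y) : ric A G H (-Y⁻¹) = -Y⁻¹ := by
  have hYd := (isUnit_iff_isUnit_det _).mp hY.isUnit
  have hWu := mul_nonsing_inv _ ((isUnit_iff_isUnit_det _).mp (isUnit_loop_dual hA hH hY))
  have hA' : Aᴴ = (1 + H * Y) * loop Aᴴ H Y := by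
    rw [loop, ← Matrix.mul_assoc, mul_nonsing_inv _ (isUnit_det_of_posSemidef hH hY.posSemidef),
      Matrix.one_mul]
  rw [ric_eq_mul_loop, loop_neg_inv hA hY hfix]
  generalize loop Aᴴ H Y = W at *
  calc Aᴴ * -Y⁻¹ * (Y * W⁻¹ * Y⁻¹) + H
      = -(Aᴴ * (Y⁻¹ * Y) * W⁻¹ * Y⁻¹) + H := by noncomm_ring
    _ = -((1 + H * Y) * (W * W⁻¹) * Y⁻¹) + H := by
        rw [nonsing_inv_mul _ hYd, Matrix.mul_one, hA']
        noncomm_ring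
    _ = -Y⁻¹ - H * (Y * Y⁻¹) + H := by rw [hWu]; noncomm_ring
    _ = -Y⁻¹ := by rw [mul_nonsing_inv _ hYd]; noncomm_ring

/-- For a negative semidefinite solution `X` of the equation with invertible `A`, the matrix
`(1 + G X)⁻¹ G` is positive semidefinite although `1 + G X` need not be a product of positive
factors: it equals `G + G Q G` with `Q = -shunt G X = (A⁻¹)ᴴ (H - X) A⁻¹`. -/
lemma shunt_posSemidef_of_nonpos {X : Mat n} (hA : IsUnit A) (hG : G.PosSemidef)
    (hH : H.PosSemidef) (hX : Adm G X) (hfix : ric A G H X = X) (hneg : (-X).PosSemidef) :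
    (shunt X G).PosSemidef := by
  have hAd := (isUnit_iff_isUnit_det _).mp hA
  have hQ : (-shunt G X).PosSemidef := by
    have h1 : Aᴴ * shunt G X * A = X - H := eq_sub_of_add_eq hfix
    have h2 : -shunt G X = (A⁻¹)ᴴ * (H + -X) * A⁻¹ := by
      have h3 : (A⁻¹)ᴴ * Aᴴ = 1 := by
        rw [← conjTranspose_mul, mul_nonsing_inv _ hAd, conjTranspose_one]
      calc -shunt G X = -(((A⁻¹)ᴴ * Aᴴ) * shunt G X * (A * A⁻¹)) := by
            rw [h3, mul_nonsing_inv _ hAd]; simp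
        _ = -((A⁻¹)ᴴ * (Aᴴ * shunt G X * A) * A⁻¹) := by noncomm_ring
        _ = _ := by rw [h1]; noncomm_ring
    rw [h2]
    exact (hH.add hneg).conjTranspose_mul_mul_same _
  have hN : shunt X G = G + Gᴴ * (-shunt G X) * G := by
    have h1 := mul_nonsing_inv _ hX.2
    rw [← inv_one_add_mul hX.2, hG.1.eq, shunt]
    generalize (1 + G * X)⁻¹ = U at *
    calc U * G = (1 + G * X) * U * G - G * X * U * G := by noncomm_ring
      _ = _ := by rw [h1]; noncomm_ring
  rw [hN]
  exact hG.add (hQ.conjTranspose_mul_mul_same G)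

theorem neg_inv_le (hA : IsUnit A) (hG : G.PosSemidef) (hH : H.PosSemidef) (hY : Y.PosDef)
    (hfix : ric Aᴴ H G Y = Y) (hρ : spectralRadius ℂ (loop Aᴴ H Y) < 1) {X : Mat n}
    (hX : Adm G X) (hXfix : ric A G H X = X) (hneg : (-X).PosSemidef) : -Y⁻¹ ≤ X := by
  have hquad := ric_sub_ric_quad (A := A) (H := H) hG.1 (adm_neg_inv hA hH hY hfix) hX
  rw [ric_neg_inv hA hH hY hfix, hXfix] at hquad
  have hN := shunt_posSemidef_of_nonpos hA hG hH hX hXfix hneg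
  have hTu := mul_nonsing_inv _
    ((isUnit_iff_isUnit_det _).mp (isUnit_loop_neg_inv hA hH hY hfix))
  have hS : spectralRadius ℂ (loop A G (-Y⁻¹))⁻¹ < 1 := by
    rwa [spectralRadius, spectrum_loop_neg_inv_inv hA hH hY hfix]
  set T := loop A G (-Y⁻¹)
  have hE : (X - -Y⁻¹).IsHermitian := hX.1.sub hY.inv.1.neg
  rw [← sub_nonneg]
  refine nonneg_of_conj_le hS ?_
  have hTu' : (T⁻¹)ᴴ * Tᴴ = 1 := by rw [← conjTranspose_mul, hTu, conjTranspose_one]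
  have h1 : (T⁻¹)ᴴ * (X - -Y⁻¹) * T⁻¹
      = (X - -Y⁻¹) - (X - -Y⁻¹) * shunt X G * (X - -Y⁻¹) := by
    generalize -Y⁻¹ = V at *
    calc (T⁻¹)ᴴ * (X - V) * T⁻¹ = -((T⁻¹)ᴴ * (V - X) * T⁻¹) := by noncomm_ring
      _ = -((T⁻¹)ᴴ * (Tᴴ * ((V - X) + (V - X) * shunt X G * (V - X)) * T) * T⁻¹) := by
          rw [← hquad]
      _ = -(((T⁻¹)ᴴ * Tᴴ) * ((V - X) + (V - X) * shunt X G * (V - X)) * (T * T⁻¹)) := by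
          noncomm_ring
      _ = _ := by rw [hTu, hTu']; noncomm_ring
  rw [h1]
  exact sub_le_self _ (mul_mul_nonneg hN hE)

theorem eq_neg_inv_of_antistab (hA : IsUnit A) (hG : G.PosSemidef) (hH : H.PosSemidef)
    (hY : Y.PosDef) (hfix : ric Aᴴ H G Y = Y) (hρ : spectralRadius ℂ (loop Aᴴ H Y) < 1)
    {X : Mat n} (hX : Adm G X) (hXfix : ric A G H X = X) (hmu : 1 ≤ DARE.mu (loop A G X)) :
    X = -Y⁻¹ := by
  have hsub := ric_sub_ric (A := A) (H := H) hG.1 hX (adm_neg_inv hA hH hY hfix)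
  rw [ric_neg_inv hA hH hY hfix, hXfix] at hsub
  have hTu := mul_nonsing_inv _
    ((isUnit_iff_isUnit_det _).mp (isUnit_loop_neg_inv hA hH hY hfix))
  have hS : spectralRadius ℂ (loop A G (-Y⁻¹))⁻¹ < 1 := by
    rwa [spectralRadius, spectrum_loop_neg_inv_inv hA hH hY hfix]
  have hUu := mul_nonsing_inv _ ((isUnit_iff_isUnit_det _).mp (isUnit_of_one_le_mu hmu))
  have hU := spectralRadius_inv_le_one hmu
  generalize loop A G (-Y⁻¹) = T at *
  generalize loop A G X = U at *
  rw [← sub_eq_zero]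
  refine eq_zero_of_eq_conj hU hS ?_
  have hUu' : (U⁻¹)ᴴ * Uᴴ = 1 := by rw [← conjTranspose_mul, hUu, conjTranspose_one]
  conv_rhs => rw [hsub]
  generalize X - -Y⁻¹ = D at *
  calc D = ((U⁻¹)ᴴ * Uᴴ) * D * (T * T⁻¹) := by rw [hUu', hTu]; simp
    _ = _ := by noncomm_ring

end Antistabilizing

/-! ### Solution sets and stabilizing feedback -/

lemma seqZ_eq (A : Mat n) (B : Matrix (Fin n) (Fin m) ℂ) (R : Mat m)
    (C : Matrix (Fin l) (Fin n) ℂ) (k : ℕ) :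
    DARE.seqZ A B R C k = (ric Aᴴ (DARE.hMat C) (DARE.gMat B R))^[k + 1] 0 := by
  induction k with
  | zero => simp [DARE.seqZ]
  | succ k ih => rw [DARE.seqZ, opD_eq, ih, ← Function.iterate_succ_apply' (ric _ _ _)]

lemma mem_solR_iff {A : Mat n} {B : Matrix (Fin n) (Fin m) ℂ} {R : Mat m}
    {C : Matrix (Fin l) (Fin n) ℂ} (hR : R.PosDef) {X : Mat n} :
    X ∈ DARE.solR A B R C ↔
      Adm (DARE.gMat B R) X ∧ ric A (DARE.gMat B R) (DARE.hMat C) X = X := by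
  rw [DARE.solR, Set.mem_ofPred_eq, mem_domR_iff hR, opR_eq, eq_comm (a := X)]

lemma mem_solR_psd_iff {A : Mat n} {B : Matrix (Fin n) (Fin m) ℂ} {R : Mat m}
    {C : Matrix (Fin l) (Fin n) ℂ} (hR : R.PosDef) {X : Mat n} :
    X ∈ DARE.solR A B R C ∩ DARE.psd n ↔
      X.PosSemidef ∧ ric A (DARE.gMat B R) (DARE.hMat C) X = X := by
  rw [Set.mem_inter_iff, mem_solR_iff hR]
  exact ⟨fun h => ⟨h.2, h.1.2⟩, fun h => ⟨⟨adm_of_posSemidef (gMat_posSemidef B hR) h.1, h.2⟩, h.1⟩⟩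

lemma mem_geR_psd_iff {A : Mat n} {B : Matrix (Fin n) (Fin m) ℂ} {R : Mat m}
    {C : Matrix (Fin l) (Fin n) ℂ} (hR : R.PosDef) {X : Mat n} :
    X ∈ DARE.geR A B R C ∩ DARE.psd n ↔
      X.PosSemidef ∧ ric A (DARE.gMat B R) (DARE.hMat C) X ≤ X := by
  rw [Set.mem_inter_iff, DARE.geR, Set.mem_ofPred_eq, opR_eq]
  exact ⟨fun h => ⟨h.2, h.1.2⟩, fun h => ⟨⟨psd_mem_domR hR h.1, h.2⟩, h.1⟩⟩

lemma almostStabD_iff {A : Mat n} {B : Matrix (Fin n) (Fin m) ℂ} {R : Mat m}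
    {C : Matrix (Fin l) (Fin n) ℂ} {Y : Mat n} :
    DARE.AlmostStabD A B R C Y ↔ Adm (DARE.hMat C) Y ∧
      ric Aᴴ (DARE.hMat C) (DARE.gMat B R) Y = Y ∧
      spectralRadius ℂ (loop Aᴴ (DARE.hMat C) Y) ≤ 1 := by
  rw [DARE.AlmostStabD, opD_eq, eq_comm (a := Y), Adm, isUnit_iff_ne_zero]
  rfl

/-- A stabilizing solution is the only almost stabilizing one, among all Hermitian solutions. -/
lemma eq_of_almost_stabilizing {A G H X Y : Mat n} (hG : G.IsHermitian) (hX : Adm G X)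
    (hY : Adm G Y) (hXfix : ric A G H X = X) (hYfix : ric A G H Y = Y)
    (hXρ : spectralRadius ℂ (loop A G X) ≤ 1) (hYρ : spectralRadius ℂ (loop A G Y) < 1) :
    X = Y := by
  have h := ric_sub_ric (A := A) (H := H) hG hX hY
  rw [hXfix, hYfix] at h
  exact sub_eq_zero.mp (eq_zero_of_eq_conj hXρ hYρ h)

lemma sq_lt_one {ρ : ℝ≥0∞} (h : ρ < 1) : ρ ^ 2 < 1 := pow_lt_one' h two_ne_zero

/-- Controllability provides a feedback `S` with stable closed loop: the solution of the
equation with `H` replaced by the identity. -/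
lemma exists_stabilizing {A : Mat n} {B : Matrix (Fin n) (Fin m) ℂ} {R : Mat m} (hR : R.PosDef)
    (hAB : DARE.Controllable A B) :
    ∃ S ∈ DARE.domR B R, spectralRadius ℂ (DARE.clR A B R S) < 1 := by
  have hG := gMat_posSemidef B hR
  obtain ⟨M, hM⟩ := exists_iterate_le hG PosSemidef.one (posDef_iterate hR hAB PosSemidef.one)
  obtain ⟨S, hS, hfix, -⟩ := exists_tendsto_iterate_zero hG PosSemidef.one hM
  refine ⟨S, psd_mem_domR hR hS, ?_⟩
  rw [clR_eq_loop hR (psd_mem_domR hR hS)]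
  exact spectralRadius_loop_lt_one hG PosSemidef.one hS hfix fun y z _ hy => by simpa using hy

/-- The cost of a stabilizing feedback `F_S` dominates its own image under the Riccati operator
and every positive semidefinite solution. -/
lemma exists_steinStart {A : Mat n} {B : Matrix (Fin n) (Fin m) ℂ} {R : Mat m}
    {C : Matrix (Fin l) (Fin n) ℂ} (hR : R.PosDef) {S : Mat n}
    (hρ : spectralRadius ℂ (DARE.clR A B R S) < 1) :
    ∃ X₀ : Mat n, X₀.PosSemidef ∧ DARE.SteinStart A B R C S X₀ ∧
      (∀ Y, DARE.SteinStart A B R C S Y → Y = X₀) ∧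
      ric A (DARE.gMat B R) (DARE.hMat C) X₀ ≤ X₀ ∧
      ∀ X : Mat n, X.PosSemidef → ric A (DARE.gMat B R) (DARE.hMat C) X = X → X ≤ X₀ := by
  have hQ : (DARE.hMat C + (DARE.fbR A B R S)ᴴ * R * DARE.fbR A B R S).PosSemidef :=
    (hMat_posSemidef C).add (hR.posSemidef.conjTranspose_mul_mul_same _)
  obtain ⟨X₀, hX₀, hst⟩ := exists_stein hρ hQ
  have hpol := fun (X : Mat n) (hX : X.PosSemidef) =>
    ric_le_feedback (A := A) (H := DARE.hMat C) (B := B) hR hX (DARE.fbR A B R S)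
  refine ⟨X₀, hX₀, ⟨hX₀.1, hst⟩, fun Y hY => stein_injective hρ ?_, ?_, fun X hX hfix => ?_⟩
  · rw [stein_apply, stein_apply, hst, hY.2]
  · refine (hpol X₀ hX₀).trans (le_of_eq ?_)
    rw [← hst, DARE.clR]
    abel
  · rw [← sub_nonneg]
    refine nonneg_of_conj_le hρ ?_
    have h1 := hpol X hX
    rw [hfix, ← hst, ← DARE.clR] at h1
    rw [← sub_nonneg] at h1 ⊢
    convert h1 using 1
    noncomm_ring

end Riccati

end

theorem corollary4p3 {n m l : ℕ} (A : Matrix (Fin n) (Fin n) ℂ) (B : Matrix (Fin n) (Fin m) ℂ)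
    (R : Matrix (Fin m) (Fin m) ℂ) (C : Matrix (Fin l) (Fin n) ℂ) (hR : R.PosDef)
    (r : ℕ) (hr : 1 < r) (hAB : DARE.Controllable A B)
    (hD : (DARE.geD A B R C ∩ DARE.psd n).Nonempty) :
    -- every matrix inverted in the iterations is nonsingular
    (∀ k, DARE.seqZ A B R C k ∈ DARE.domD C) ∧
    (∀ k j, (1 + (DARE.afpi r (DARE.initTriple A B R C) k).G *
      (DARE.inner (DARE.afpi r (DARE.initTriple A B R C) k) j).H).det ≠ 0) ∧
    -- part (i)
    (∀ k, (DARE.afpi r (DARE.initTriple A B R C) k).G = DARE.seqZ A B R C (r ^ k - 1)) ∧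
    (∃ Ginf : Matrix (Fin n) (Fin n) ℂ,
      Ginf.PosDef ∧
      DARE.AlmostStabD A B R C Ginf ∧
      (∀ Y, DARE.AlmostStabD A B R C Y → Y = Ginf) ∧
      DARE.RSuperlinear r (fun k => (DARE.afpi r (DARE.initTriple A B R C) k).G) Ginf ∧
      DARE.rootLimsup r (fun k => (DARE.afpi r (DARE.initTriple A B R C) k).G) Ginf
        ≤ DARE.rhoD (DARE.clD A C Ginf) ^ 2 ∧
      DARE.rhoD (DARE.clD A C Ginf) ^ 2 < 1 ∧
      (IsUnit A →
        IsLeast (DARE.solR A B R C ∩ DARE.nsd n) (-Ginf⁻¹) ∧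
        DARE.AlmostAntistabR A B R C (-Ginf⁻¹) ∧
        (∀ X, DARE.AlmostAntistabR A B R C X → X = -Ginf⁻¹) ∧
        IsUnit (DARE.clR A B R (-Ginf⁻¹)) ∧
        DARE.rhoD (DARE.clD A C Ginf) = DARE.rhoD ((DARE.clR A B R (-Ginf⁻¹))⁻¹))) ∧
    -- part (ii), the sequence of the matrices H
    (∃ Xmin : Matrix (Fin n) (Fin n) ℂ,
      IsLeast (DARE.solR A B R C ∩ DARE.psd n) Xmin ∧
      IsLeast (DARE.geR A B R C ∩ DARE.psd n) Xmin ∧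
      DARE.RSuperlinear r (fun k => (DARE.afpi r (DARE.initTriple A B R C) k).H) Xmin ∧
      DARE.rootLimsup r (fun k => (DARE.afpi r (DARE.initTriple A B R C) k).H) Xmin
        ≤ DARE.rhoD (DARE.clR A B R Xmin) ^ 2 ∧
      DARE.rhoD (DARE.clR A B R Xmin) ^ 2 < 1) ∧
    -- part (ii), the sequence of the matrices X
    (∃ S ∈ DARE.domR B R, spectralRadius ℂ (DARE.clR A B R S) < 1) ∧
    (∃ Xmax : Matrix (Fin n) (Fin n) ℂ,
      IsGreatest (DARE.solR A B R C ∩ DARE.psd n) Xmax ∧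
      ∀ S ∈ DARE.domR B R, spectralRadius ℂ (DARE.clR A B R S) < 1 →
        ∃ X₀ : Matrix (Fin n) (Fin n) ℂ,
          DARE.SteinStart A B R C S X₀ ∧
          (∀ Y, DARE.SteinStart A B R C S Y → Y = X₀) ∧
          (∀ k, (1 + (DARE.afpi r (DARE.initTriple A B R C) k).G * X₀).det ≠ 0) ∧
          (spectralRadius ℂ (DARE.clR A B R Xmax) < 1 →
            DARE.RSuperlinear r (DARE.afpiX r (DARE.initTriple A B R C) X₀) Xmax ∧
            DARE.rootLimsup r (DARE.afpiX r (DARE.initTriple A B R C) X₀) Xmax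
              ≤ spectralRadius ℂ (DARE.clR A B R Xmax) ^ 2)) := by
  open Riccati in
  have hG := gMat_posSemidef B hR
  have hH := hMat_posSemidef C
  have hmode := noHiddenMode_of_controllable hR hAB
  have hrep : ∀ k, Represents A (DARE.gMat B R) (DARE.hMat C)
      (DARE.afpi r (DARE.initTriple A B R C) k) (r ^ k) := Represents.afpi hG hH hr
  have hZpsd : ∀ k, (DARE.seqZ A B R C k).PosSemidef := fun k => by
    rw [seqZ_eq]
    exact iterate_ric_posSemidef hH hG Matrix.PosSemidef.zero _
  refine ⟨fun k => ?_, fun k j => ?_, fun k => ?_, ?_, ?_, exists_stabilizing hR hAB, ?_⟩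
  · exact ⟨(hZpsd k).1, (isUnit_det_of_posSemidef hH (hZpsd k)).ne_zero⟩
  · exact (isUnit_det_of_posSemidef (hrep k).posG ((hrep k).inner hG hH j).posH).ne_zero
  · rw [(hrep k).G_eq, seqZ_eq, Nat.sub_add_cancel (Nat.one_le_pow _ _ (by omega))]
  · obtain ⟨Y₀, ⟨-, hY₀r⟩, hY₀⟩ := hD
    rw [opD_eq] at hY₀r
    obtain ⟨Y, hY, hfix, ht, hle, -⟩ := exists_tendsto_iterate_zero hH hG
      (iterate_zero_le hH hG hY₀ hY₀r)
    have hYpos : Y.PosDef := by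
      have h1 := (posDef_iterate (A := A) hR hAB hH).add_posSemidef (Matrix.le_iff.mp (hle n))
      rwa [add_sub_cancel] at h1
    -- controllability of `(A, B)` is the observability condition of the dual equation
    have hρ := spectralRadius_loop_lt_one hH hG hY hfix
      (by rwa [Matrix.conjTranspose_conjTranspose])
    have hlim : DARE.rootLimsup r (fun k => (DARE.afpi r (DARE.initTriple A B R C) k).G) Y
        ≤ DARE.rhoD (DARE.clD A C Y) ^ 2 := by
      refine rootLimsup_le (u := fun N => (ric Aᴴ (DARE.hMat C) (DARE.gMat B R))^[N] 0) hr
        (Filter.Eventually.of_forall fun k => (hrep k).G_eq) fun s hs => ?_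
      refine rate_of_iterate_zero hH hG hY hfix (fun z hz hz1 => ?_) hle ht hs
      exact absurd (norm_lt_of_spectralRadius_lt (by rwa [ENNReal.ofReal_one]) hz)
        (not_lt.mpr hz1)
    have hlt := sq_lt_one (rhoD_lt_one (DARE.clD A C Y))
    refine ⟨Y, hYpos, almostStabD_iff.mpr ⟨adm_of_posSemidef hH hY, hfix, hρ.le⟩,
      fun Z hZ => ?_, rSuperlinear_of_rootLimsup_le hlt hlim, hlim, hlt, fun hA => ?_⟩
    · obtain ⟨hZ1, hZ2, hZ3⟩ := almostStabD_iff.mp hZ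
      exact eq_of_almost_stabilizing hH.1 hZ1 (adm_of_posSemidef hH hY) hZ2 hfix hZ3 hρ
    · have hadm := adm_neg_inv hA hH hYpos hfix
      have hloop := clR_eq_loop (A := A) hR ((mem_domR_iff hR).mpr hadm)
      have hsol := (mem_solR_iff hR).mpr ⟨hadm, ric_neg_inv hA hH hYpos hfix⟩
      have hunit := isUnit_loop_neg_inv hA hH hYpos hfix
      have hspec := spectrum_loop_neg_inv_inv hA hH hYpos hfix
      refine ⟨⟨⟨hsol, ?_⟩, fun X hX => ?_⟩, ⟨hsol, ?_⟩, fun X hX => ?_, ?_, ?_⟩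
      · rw [DARE.nsd, Set.mem_ofPred_eq, neg_neg]
        exact hYpos.inv.posSemidef
      · obtain ⟨hX1, hX2⟩ := (mem_solR_iff hR).mp hX.1
        exact neg_inv_le hA hG hH hYpos hfix hρ hX1 hX2 hX.2
      · rw [hloop]
        exact one_le_mu_of_inv hunit (by rwa [spectralRadius, hspec])
      · obtain ⟨hX1, hX2⟩ := (mem_solR_iff hR).mp hX.1
        have hmu := hX.2
        rw [clR_eq_loop hR hX.1.1] at hmu
        exact eq_neg_inv_of_antistab hA hG hH hYpos hfix hρ hX1 hX2 hmu
      · rwa [hloop]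
      · rw [hloop, DARE.rhoD, DARE.rhoD, hspec]
        rfl
  · obtain ⟨M, hM⟩ := exists_iterate_le hG hH (posDef_iterate hR hAB hH)
    obtain ⟨X, hX, hfix, ht, hle, hleast⟩ := exists_tendsto_iterate_zero hG hH hM
    have hloop := clR_eq_loop (A := A) (B := B) hR (psd_mem_domR hR hX)
    have hlim : DARE.rootLimsup r (fun k => (DARE.afpi r (DARE.initTriple A B R C) k).H) X
        ≤ DARE.rhoD (DARE.clR A B R X) ^ 2 := by
      rw [hloop]
      refine rootLimsup_le (u := fun N => (ric A (DARE.gMat B R) (DARE.hMat C))^[N] 0) hr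
        (Filter.Eventually.of_forall fun k => (hrep k).H_eq) fun s hs => ?_
      exact rate_of_iterate_zero hG hH hX hfix
        (fun z _ hz1 k x hx => mulVec_eq_zero_of_pow_sub hG hH hX hfix hmode hz1 k x hx) hle ht hs
    have hlt := sq_lt_one (rhoD_lt_one (DARE.clR A B R X))
    refine ⟨X, ⟨(mem_solR_psd_iff hR).mpr ⟨hX, hfix⟩, fun Y hY => ?_⟩,
      ⟨(mem_geR_psd_iff hR).mpr ⟨hX, hfix.le⟩, fun Y hY => ?_⟩,
      rSuperlinear_of_rootLimsup_le hlt hlim, hlim, hlt⟩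
    · obtain ⟨hY1, hY2⟩ := (mem_solR_psd_iff hR).mp hY
      exact hleast Y hY1 hY2.le
    · obtain ⟨hY1, hY2⟩ := (mem_geR_psd_iff hR).mp hY
      exact hleast Y hY1 hY2
  · obtain ⟨S₀, -, hS₀⟩ := exists_stabilizing hR hAB
    obtain ⟨X₁, hX₁, -, -, hX₁r, hX₁ge⟩ := exists_steinStart (C := C) hR hS₀
    obtain ⟨X, hX, hfix, -, -, hgreatest⟩ := exists_tendsto_iterate_of_ric_le hG hH hX₁ hX₁r
    refine ⟨X, ⟨(mem_solR_psd_iff hR).mpr ⟨hX, hfix⟩, fun Y hY => ?_⟩, fun S _ hS => ?_⟩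
    · obtain ⟨hY1, hY2⟩ := (mem_solR_psd_iff hR).mp hY
      exact hgreatest Y hY1 hY2 (hX₁ge Y hY1 hY2)
    · obtain ⟨X₀, hX₀, hst, huniq, -, hX₀ge⟩ := exists_steinStart (C := C) hR hS
      refine ⟨X₀, hst, huniq,
        fun k => (isUnit_det_of_posSemidef (hrep k).posG hX₀).ne_zero, fun hρ => ?_⟩
      have hlim : DARE.rootLimsup r (DARE.afpiX r (DARE.initTriple A B R C) X₀) X
          ≤ spectralRadius ℂ (DARE.clR A B R X) ^ 2 := by
        rw [clR_eq_loop hR (psd_mem_domR hR hX)]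
        refine rootLimsup_le (u := fun N => (ric A (DARE.gMat B R) (DARE.hMat C))^[N] X₀) hr ?_
          fun s hs => rate_of_iterate_of_le hG hH hX hfix (hX₀ge X hX hfix) hs
        filter_upwards [Filter.eventually_ge_atTop 1] with k hk
        obtain ⟨k, rfl⟩ := Nat.exists_eq_add_of_le' hk
        rw [DARE.afpiX, ← (hrep (k + 1)).primal X₀ hX₀, ric, shunt]
        simp only [Matrix.mul_assoc]
      exact ⟨rSuperlinear_of_rootLimsup_le (sq_lt_one hρ) hlim, hlim⟩
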